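/- Let $n\ge 1$. A circuit in $\mathbb{R}^n$ is a set $\mathcal{W}\subset\mathbb{R}^n$ of $n+2$ points that is minimally affinely dependent, i.e. affinely dependent while each proper subset is affinely independent. A (generalized) polynomial system with support $\mathcal{W}$ is a system $f_1(z)=\dots=f_n(z)=0$ in $n$ variables $z=(z_1,\dots,z_n)$, where each $f_j=\sum_{w\in\mathcal{W}}c_{j,w}z^w$ is a real linear combination of monomials $z^w=z_1^{w_1}\cdots z_n^{w_n}$ and each $w\in\mathcal{W}$ occurs with a non-zero coefficient in at least one $f_j$. A non-degenerate positive solution is a solution with all $z_i>0$ at which the Jacobian determinant of $(f_1,\dots,f_n)$ is non-zero. Theorem. Let $\mathcal{W}$ be a circuit in $\mathbb{R}^n$ and put $m=\lceil (n+2)/2\rceil$. There is a polynomial system with support $\mathcal{W}$ that has exactly $n+1$ non-degenerate positive solutions if and only if there is a bijection $\{1,\dots,n+2\}\to\mathcal{W}$, $i\mapsto w_i$, such that every non-trivial affine relation $\sum_{i=1}^{n+2}\lambda_iw_i=0$, $\sum_{i=1}^{n+2}\lambda_i=0$ on $\mathcal{W}$ can be written, by bringing terms to the other side, as $$\sum_{i=1}^{m}\alpha_iw_i=\sum_{i=m+1}^{n+2}\beta_iw_i$$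 (that is, $(\lambda_i)_i$ or $(-\lambda_i)_i$ equals $(\alpha_1,\dots,\alpha_m,-\beta_{m+1},\dots,-\beta_{n+2})$), where all $\alpha_i,\beta_i$ are positive and $$\sum_{i=1}^{r}\alpha_i<\sum_{i=m+1}^{m+r}\beta_i<\sum_{i=1}^{r+1}\alpha_i\qquad\text{for } r=1,\dots,\lfloor n/2\rfloor .$$ -/

import Mathlib

namespace Circuit

noncomputable section

/-- The generalized monomial `z ^ w = z₁ ^ w₁ ⋯ zₙ ^ wₙ` with real exponent vector `w`;
it is only used at points `z` with positive coordinates. -/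
def monom {n : ℕ} (w z : Fin n → ℝ) : ℝ := ∏ i, z i ^ w i

/-- A (generalized) polynomial in `n` variables: a finite real linear combination of monomials
with real exponent vectors, given by its finitely supported family of coefficients. -/
abbrev GenPoly (n : ℕ) : Type := (Fin n → ℝ) →₀ ℝ

/-- The value `∑ c_w z ^ w` of a generalized polynomial. -/
def GenPoly.eval {n : ℕ} (f : GenPoly n) (z : Fin n → ℝ) : ℝ :=
  f.sum fun w c => c * monom w z

/-- The system `f₁, …, fₙ`, seen as a map. -/
def evalSystem {n : ℕ} (f : Fin n → GenPoly n) (z : Fin n → ℝ) : Fin n → ℝ :=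
  fun j => (f j).eval z

/-- The support of a system is the union of the supports (exponents with nonzero coefficient)
of the individual polynomials. -/
def systemSupport {n : ℕ} (f : Fin n → GenPoly n) : Set (Fin n → ℝ) :=
  ⋃ j, ((f j).support : Set (Fin n → ℝ))

/-- The non-degenerate positive solutions of `f₁ = ⋯ = fₙ = 0`: the solutions in the open positive
orthant at which the Jacobian determinant of the system does not vanish. -/
def nondegPosSolutions {n : ℕ} (f : Fin n → GenPoly n) : Set (Fin n → ℝ) :=
  {z | (∀ i, 0 < z i) ∧ evalSystem f z = 0 ∧ (fderiv ℝ (evalSystem f) z).det ≠ 0}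

/-- A circuit in `ℝⁿ`: a set of `n + 2` points that is minimally affinely dependent. -/
def IsCircuit {n : ℕ} (W : Set (Fin n → ℝ)) : Prop :=
  W.encard = n + 2 ∧
  ¬ AffineIndependent ℝ ((↑) : W → (Fin n → ℝ)) ∧
  ∀ S : Set (Fin n → ℝ), S ⊂ W → AffineIndependent ℝ ((↑) : S → (Fin n → ℝ))

/-- `l` is a (nontrivial) affine relation on the points `w 0, …, w (n + 1)`. -/
def IsAffineRelation {n : ℕ} (w : Fin (n + 2) → (Fin n → ℝ)) (l : Fin (n + 2) → ℝ) : Prop :=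
  l ≠ 0 ∧ ∑ i, l i = 0 ∧ ∑ i, l i • w i = 0

/-- The relation `∑ l_i w_i = 0` is `∑_{i ≤ m} α_i w_i = ∑_{m < i} β_i w_i`, after all terms are
brought to one of the two sides. The points are numbered from `1` in `α` and `β`, so that
`i : Fin (n + 2)` is the point with number `i + 1`. -/
def IsWrittenAs {n : ℕ} (l : Fin (n + 2) → ℝ) (m : ℕ) (α β : ℕ → ℝ) : Prop :=
  (∀ i : Fin (n + 2), l i = if (i : ℕ) + 1 ≤ m then α (i + 1) else -β (i + 1)) ∨
  (∀ i : Fin (n + 2), -l i = if (i : ℕ) + 1 ≤ m then α (i + 1) else -β (i + 1))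

end

end Circuit

/-!
The argument is Gale duality for circuits, followed by a rule of signs. Let `λ` be the affine relation
of the circuit, which is unique up to scaling. A positive vector `x` is, up to scaling, the vector of
monomials `z ^ wᵢ` at a unique positive `z` if and only if `∑ λᵢ log xᵢ = 0`. If a system has
a non-degenerate solution, the kernel of its coefficient matrix is a plane, so after normalization the
solutions lie on a line `xᵢ = uᵢ (1 + eᵢ t)`, and they are the roots of `g = ∑ λᵢ log (1 + eᵢ t)` on an
interval on which all factors are positive (`exists_gale_dual`). Non-degenerate solutions correspond to
simple roots.

A summation by parts writes the numerator of `g'` as `∑ μₖ (eₖ - eₖ₊₁) Qₖ`, where `μₖ` is the `k`-th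
partial sum of `λ` and `Qₖ` is the product of all factors except those with numbers `k` and `k + 1`
(`critPoly`). It has degree at most `n`, and Rolle's theorem gives at most `n + 1` simple roots of `g`.
If there are `n + 1`, then the numerator is a constant multiple of `∏ (t - ζ)` with `n` points `ζ` of
the interval. If the `eᵢ` are in increasing order, such a product has coefficients of alternating signs
in the basis `Qₖ`: this is `exists_alternating_gap_expansion`, which multiplies in the factors `t - ζ`
one by one. Hence the `μₖ` alternate in sign (`partialSum_mul_partialSum_neg`).

Conversely, suppose that the `μₖ` alternate. For `eᵢ = exp (-L sᵢ)`, the function `g`, in the variable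
`log t / L`, is close to `L` times a piecewise linear function with the slopes `μₖ` between the
breakpoints `sₖ`. With suitable breakpoints it crosses a fixed level on each of its `n + 1` segments
(`exists_alternating_values`). Since `n + 1` is also the maximum, the roots are simple, and a matrix
whose kernel is the corresponding plane gives the system (`exists_system_of_simple_roots`).

The inequalities of the statement express the alternation of the `μₖ` for the order of the points in
which the two sides of the relation interleave (`interleave`).
-/

namespace Circuit

open Finset

/-! ### Products of linear factors with a gap -/

section

open Polynomial

/-- The product of the linear factors `1 + e j * X`, `j < N`, with those of the gap
`a ≤ j < b` left out. -/
noncomputable def gapPoly (e : ℕ → ℝ) (N a b : ℕ) : ℝ[X] :=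
  ∏ j ∈ range N \ Ico a b, (1 + C (e j) * X)

theorem gapPoly_succ_left (e : ℕ → ℝ) {N a b : ℕ} (hab : a < b) (hb : b ≤ N) :
    gapPoly e N (a + 1) b = (1 + C (e a) * X) * gapPoly e N a b := by
  unfold gapPoly
  rw [← prod_insert (f := fun j => 1 + C (e j) * X) (by simp [hab])]
  congr 1
  ext j
  simp only [mem_sdiff, mem_range, mem_Ico, mem_insert]
  omega

theorem gapPoly_eq_mul_succ_right (e : ℕ → ℝ) {N a b : ℕ} (hab : a ≤ b) (hb : b < N) :
    gapPoly e N a b = (1 + C (e b) * X) * gapPoly e N a (b + 1) := by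
  unfold gapPoly
  rw [← prod_insert (f := fun j => 1 + C (e j) * X) (by simp [hab])]
  congr 1
  ext j
  simp only [mem_sdiff, mem_range, mem_Ico, mem_insert]
  omega

theorem natDegree_prod_one_add_le (e : ℕ → ℝ) (S : Finset ℕ) :
    (∏ j ∈ S, (1 + C (e j) * X)).natDegree ≤ #S := by
  refine (natDegree_prod_le _ _).trans ?_
  rw [card_eq_sum_ones]
  refine sum_le_sum fun j _ => ?_
  compute_degree

theorem card_range_sdiff_pair {n k : ℕ} (hk : k < n + 1) :
    #(range (n + 2) \ Ico k (k + 2)) = n := by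
  rw [card_sdiff_of_subset]
  · simp
  · intro j
    simp only [mem_range, mem_Ico]
    omega

/-- With all `ζ` in `Z` on the positive side of the increasing factors, the polynomial
`∏ (X - ζ)` has coefficients of alternating signs in the basis of the products that omit a gap of
fixed length. Multiplication by one more `X - ζ` shortens the gap: `X - ζ` is a combination
of the two factors at the ends of the gap, with coefficients of opposite signs. -/
theorem exists_alternating_gap_expansion {e : ℕ → ℝ} {N : ℕ}
    (he : ∀ i j, i < j → j < N → e i < e j) (Z : Finset ℝ)
    (hZ : ∀ ζ ∈ Z, ∀ j < N, 0 < 1 + e j * ζ) (hN : #Z + 2 ≤ N) :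
    ∃ a : ℕ → ℝ, (∀ k ≤ #Z, 0 < (-1) ^ k * a k) ∧
      ∏ ζ ∈ Z, (X - C ζ) = ∑ k ∈ range (#Z + 1), C (a k) * gapPoly e N k (k + N - #Z) := by
  induction Z using Finset.induction_on with
  | empty =>
    refine ⟨fun _ => 1, by simp, ?_⟩
    simp [gapPoly]
  | insert ζ Z hζ ih =>
    rw [card_insert_of_notMem hζ] at hN ⊢
    obtain ⟨a, ha, hexp⟩ := ih (fun x hx => hZ x (mem_insert_of_mem hx)) (by omega)
    set r := #Z with hr
    have hζ0 := hZ ζ (mem_insert_self _ _)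
    let A : ℕ → ℝ := fun k => (1 + e k * ζ) / (e (k + N - (r + 1)) - e k)
    let B : ℕ → ℝ := fun k => -((1 + e (k + N - (r + 1)) * ζ) / (e (k + N - (r + 1)) - e k))
    have hdiff : ∀ k ≤ r, 0 < e (k + N - (r + 1)) - e k := fun k hk =>
      sub_pos.2 (he _ _ (by omega) (by omega))
    have hA : ∀ k ≤ r, 0 < A k := fun k hk => div_pos (hζ0 k (by omega)) (hdiff k hk)
    have hB : ∀ k ≤ r, 0 < -B k := fun k hk => by
      simpa [B] using div_pos (hζ0 (k + N - (r + 1)) (by omega)) (hdiff k hk)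
    let u : ℕ → ℝ := fun k => if k ≤ r then A k * a k else 0
    let v : ℕ → ℝ := fun k => if k = 0 then 0 else B (k - 1) * a (k - 1)
    have hu : ∀ k ≤ r, 0 < (-1) ^ k * u k := fun k hk => by
      have := mul_pos (hA k hk) (ha k hk)
      simp only [u, hk, if_true]
      linarith
    have hv : ∀ k ≤ r, 0 < (-1) ^ (k + 1) * v (k + 1) := fun k hk => by
      have := mul_pos (hB k hk) (ha k hk)
      simp only [v, Nat.succ_ne_zero, if_false, Nat.add_sub_cancel]
      rw [pow_succ]
      linarith
    refine ⟨fun k => u k + v k, ?_, ?_⟩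
    · intro k hk
      rcases k with _ | k
      · have := hu 0 (Nat.zero_le _)
        simpa [v] using this
      · have h1 := hv k (by omega)
        rcases Nat.lt_or_ge r (k + 1) with h | h
        · simpa [u, Nat.not_le.2 h] using h1
        · have := hu (k + 1) h
          rw [mul_add]
          linarith
    · rw [prod_insert hζ, hexp, mul_sum]
      have hterm : ∀ k ∈ range (r + 1),
          (X - C ζ) * (C (a k) * gapPoly e N k (k + N - r)) =
            C (u k) * gapPoly e N k (k + N - (r + 1)) +
            C (v (k + 1)) * gapPoly e N (k + 1) (k + 1 + N - (r + 1)) := by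
        intro k hk
        have hk : k ≤ r := by simpa [Nat.lt_succ_iff] using hk
        have e1 : gapPoly e N k (k + N - (r + 1)) =
            (1 + C (e (k + N - (r + 1))) * X) * gapPoly e N k (k + N - r) := by
          have := gapPoly_eq_mul_succ_right e (N := N) (a := k) (b := k + N - (r + 1))
            (by omega) (by omega)
          rwa [show k + N - (r + 1) + 1 = k + N - r by omega] at this
        have e2 : gapPoly e N (k + 1) (k + 1 + N - (r + 1)) =
            (1 + C (e k) * X) * gapPoly e N k (k + N - r) := by
          rw [show k + 1 + N - (r + 1) = k + N - r by omega]
          exact gapPoly_succ_left e (by omega) (by omega)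
        have hlin : (X - C ζ : ℝ[X]) = C (A k) * (1 + C (e (k + N - (r + 1))) * X) +
            C (B k) * (1 + C (e k) * X) := by
          have h1 : A k * e (k + N - (r + 1)) + B k * e k = 1 := by
            have := (hdiff k hk).ne'
            simp only [A, B]
            field_simp
            ring
          have h2 : A k + B k = -ζ := by
            have := (hdiff k hk).ne'
            simp only [A, B]
            field_simp
            ring
          calc (X - C ζ : ℝ[X]) = C (A k + B k) +
                C (A k * e (k + N - (r + 1)) + B k * e k) * X := by
                rw [h1, h2]; simp; ring
            _ = _ := by simp only [C_add, C_mul]; ring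
        rw [e1, e2, hlin]
        simp only [u, v, hk, if_true, Nat.succ_ne_zero, if_false, Nat.add_sub_cancel, C_mul]
        ring
      rw [sum_congr rfl hterm, sum_add_distrib]
      simp only [C_add, add_mul, sum_add_distrib]
      congr 1
      · rw [sum_range_succ _ (r + 1)]
        simp [u]
      · rw [sum_range_succ' _ (r + 1)]
        simp [v]

/-- A linear relation between the products, homogenized. -/
theorem sum_mul_prod_homogeneous_eq_zero {e x : ℕ → ℝ} {n : ℕ}
    (h : ∑ k ∈ range (n + 1), C (x k) * gapPoly e (n + 2) k (k + 2) = 0) (s t : ℝ) :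
    ∑ k ∈ range (n + 1), x k * ∏ j ∈ range (n + 2) \ Ico k (k + 2), (s + e j * t) = 0 := by
  let H : ℝ → ℝ := fun s =>
    ∑ k ∈ range (n + 1), x k * ∏ j ∈ range (n + 2) \ Ico k (k + 2), (s + e j * t)
  have hc : Continuous H := by fun_prop
  have : H = fun _ => 0 := by
    refine Continuous.ext_on (dense_compl_singleton (0 : ℝ)) hc continuous_const ?_
    intro s hs
    have hs : s ≠ 0 := hs
    have h1 := congrArg (fun p => s ^ n * p.eval (t / s)) h
    simp only [gapPoly, eval_finsetSum, eval_mul, eval_C, eval_prod, eval_add, eval_one, eval_X,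
      eval_zero, mul_zero, mul_sum] at h1
    simp only [H]
    rw [← h1]
    refine sum_congr rfl fun k hk => ?_
    have hcard := card_range_sdiff_pair (mem_range.1 hk)
    rw [mul_left_comm]
    congr 1
    nth_rewrite 2 [← hcard]
    rw [← prod_const, ← prod_mul_distrib]
    refine prod_congr rfl fun j _ => ?_
    field_simp
  exact congrFun this s

/-- The products omitting two consecutive factors are linearly independent. The homogeneous
identity is evaluated at the zero `(-e k, 1)` of the factor `k`, which stays finite in the
projective line even if `e k = 0`. -/
theorem eq_zero_of_sum_gapPoly_eq_zero {e x : ℕ → ℝ} {n : ℕ}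
    (he : ∀ i j, i < j → j < n + 2 → e i < e j)
    (h : ∑ k ∈ range (n + 1), C (x k) * gapPoly e (n + 2) k (k + 2) = 0) :
    ∀ k ≤ n, x k = 0 := by
  intro k
  induction k using Nat.strong_induction_on with
  | _ k ih =>
    intro hk
    have h1 := sum_mul_prod_homogeneous_eq_zero h (-e k) 1
    rw [sum_eq_single k] at h1
    · refine (mul_eq_zero.1 h1).resolve_right (prod_ne_zero_iff.2 fun j hj => ?_)
      simp only [mem_sdiff, mem_range, mem_Ico] at hj
      rcases lt_trichotomy j k with hjk | hjk | hjk
      · have := he j k hjk (by omega)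
        simp only [mul_one]
        linarith
      · omega
      · have := he k j hjk (by omega)
        simp only [mul_one]
        linarith
    · intro i hi hik
      have hi := mem_range.1 hi
      rcases Nat.lt_or_ge i k with hlt | hge
      · rw [ih i hlt (by omega), zero_mul]
      · rw [prod_eq_zero (i := k) _ (by ring), mul_zero]
        simp only [mem_sdiff, mem_range, mem_Ico]
        omega
    · intro hk'
      exact absurd (mem_range.2 (by omega)) hk'

/-- The numerator of `∑ λᵢ eᵢ / (1 + eᵢ t)` over the common denominator `∏ (1 + eᵢ t)`, written,
after a summation by parts, with the partial sums of `λ` as coefficients. -/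
noncomputable def critPoly (l e : ℕ → ℝ) (n : ℕ) : ℝ[X] :=
  ∑ k ∈ range (n + 1),
    C ((∑ i ∈ range (k + 1), l i) * (e k - e (k + 1))) * gapPoly e (n + 2) k (k + 2)

theorem natDegree_critPoly_le (l e : ℕ → ℝ) (n : ℕ) : (critPoly l e n).natDegree ≤ n := by
  refine natDegree_sum_le_of_forall_le _ _ fun k hk => ?_
  refine natDegree_C_mul_le _ _ |>.trans ?_
  refine (natDegree_prod_one_add_le _ _).trans ?_
  rw [card_range_sdiff_pair (mem_range.1 hk)]

theorem sum_mul_eq_sum_partialSum_mul (l h : ℕ → ℝ) (m : ℕ) :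
    ∑ i ∈ range (m + 1), l i * h i =
      ∑ k ∈ range m, (∑ i ∈ range (k + 1), l i) * (h k - h (k + 1)) +
        (∑ i ∈ range (m + 1), l i) * h m := by
  induction m with
  | zero => simp
  | succ m ih =>
    rw [sum_range_succ _ (m + 1), ih, sum_range_succ (fun k => (∑ i ∈ range (k + 1), l i) * _) m,
      sum_range_succ l (m + 1)]
    ring

theorem eval_critPoly {l e : ℕ → ℝ} {n : ℕ} (hl : ∑ i ∈ range (n + 2), l i = 0) {t : ℝ}
    (ht : ∀ j < n + 2, 0 < 1 + e j * t) :
    (critPoly l e n).eval t =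
      (∑ i ∈ range (n + 2), l i * (e i / (1 + e i * t))) * ∏ j ∈ range (n + 2), (1 + e j * t) := by
  rw [sum_mul_eq_sum_partialSum_mul, hl, zero_mul, add_zero, sum_mul, critPoly, eval_finsetSum]
  refine sum_congr rfl fun k hk => ?_
  have hk := mem_range.1 hk
  have h1 := (ht k (by omega)).ne'
  have h2 := (ht (k + 1) (by omega)).ne'
  have hsub : Ico k (k + 2) ⊆ range (n + 2) := by
    intro j
    simp only [mem_range, mem_Ico]
    omega
  have hpair : ∏ j ∈ Ico k (k + 2), (1 + e j * t) = (1 + e k * t) * (1 + e (k + 1) * t) := by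
    simp [prod_Ico_succ_top]
  rw [← prod_sdiff hsub, hpair]
  simp only [gapPoly, eval_mul, eval_C, eval_prod, eval_add, eval_one, eval_X]
  generalize ∏ j ∈ range (n + 2) \ Ico k (k + 2), (1 + e j * t) = Q
  field_simp
  ring

theorem critPoly_eq_zero_of_card_lt {l e : ℕ → ℝ} {n : ℕ} {Z : Finset ℝ} (hZ : n < #Z)
    (h : ∀ ζ ∈ Z, (critPoly l e n).eval ζ = 0) : critPoly l e n = 0 :=
  eq_zero_of_natDegree_lt_card_of_eval_eq_zero' _ Z h ((natDegree_critPoly_le l e n).trans_lt hZ)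

/-- If two consecutive factors agree, the common factor can be split off from the numerator, and
the remaining degree is too small for `n` roots. -/
theorem critPoly_eq_zero_of_eq {l e : ℕ → ℝ} {n : ℕ} (hn : 1 ≤ n) {k₀ : ℕ} (hk₀ : k₀ < n + 1)
    (he : e k₀ = e (k₀ + 1)) {Z : Finset ℝ} (hZ : n ≤ #Z)
    (hpos : ∀ ζ ∈ Z, 0 < 1 + e k₀ * ζ)
    (h : ∀ ζ ∈ Z, (critPoly l e n).eval ζ = 0) : critPoly l e n = 0 := by
  have key : ∀ k ∈ range (n + 1), ∃ R : ℝ[X], R.natDegree ≤ n - 1 ∧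
      C ((∑ i ∈ range (k + 1), l i) * (e k - e (k + 1))) * gapPoly e (n + 2) k (k + 2) =
        (1 + C (e k₀) * X) * R := by
    intro k hk
    have hk := mem_range.1 hk
    rcases eq_or_ne k k₀ with rfl | hne
    · exact ⟨0, by simp, by simp [he]⟩
    · obtain ⟨j, hj, hej⟩ : ∃ j ∈ range (n + 2) \ Ico k (k + 2), e j = e k₀ := by
        rcases Nat.lt_or_ge k k₀ with hlt | hge
        · refine ⟨k₀ + 1, ?_, he.symm⟩
          simp only [mem_sdiff, mem_range, mem_Ico]
          omega
        · refine ⟨k₀, ?_, rfl⟩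
          simp only [mem_sdiff, mem_range, mem_Ico]
          omega
      refine ⟨C ((∑ i ∈ range (k + 1), l i) * (e k - e (k + 1))) *
        ∏ j ∈ (range (n + 2) \ Ico k (k + 2)).erase j, (1 + C (e j) * X), ?_, ?_⟩
      · refine (natDegree_C_mul_le _ _).trans ((natDegree_prod_one_add_le _ _).trans ?_)
        rw [card_erase_of_mem hj, card_range_sdiff_pair hk]
      · rw [gapPoly, ← mul_prod_erase _ _ hj, hej]
        ring
  choose! R hdeg hR using key
  have hfac : critPoly l e n = (1 + C (e k₀) * X) * ∑ k ∈ range (n + 1), R k := by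
    rw [critPoly, sum_congr rfl hR, mul_sum]
  have hzero : ∑ k ∈ range (n + 1), R k = 0 := by
    refine eq_zero_of_natDegree_lt_card_of_eval_eq_zero' _ Z ?_ (lt_of_le_of_lt
      (natDegree_sum_le_of_forall_le _ _ hdeg) (by omega))
    intro ζ hζ
    have := h ζ hζ
    rw [hfac, eval_mul] at this
    refine (mul_eq_zero.1 this).resolve_left ?_
    simpa using (hpos ζ hζ).ne'
  rw [hfac, hzero, mul_zero]

/-- If the numerator has all its `n` roots where the factors are positive, then the partial sums of
`λ`, taken in the order of the `e j`, alternate in sign. -/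
theorem partialSum_mul_partialSum_neg {l e : ℕ → ℝ} {n : ℕ} (hn : 1 ≤ n)
    (he : ∀ i j, i ≤ j → j < n + 2 → e i ≤ e j) {Z : Finset ℝ} (hZ : #Z = n)
    (hpos : ∀ ζ ∈ Z, ∀ j < n + 2, 0 < 1 + e j * ζ)
    (h : ∀ ζ ∈ Z, (critPoly l e n).eval ζ = 0) (hne : critPoly l e n ≠ 0) :
    ∀ k < n, (∑ i ∈ range (k + 1), l i) * (∑ i ∈ range (k + 2), l i) < 0 := by
  have hstep : ∀ k < n + 1, e k < e (k + 1) := fun k hk =>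
    lt_of_le_of_ne (he _ _ (Nat.le_succ k) (by omega)) fun heq =>
      hne (critPoly_eq_zero_of_eq hn hk heq hZ.ge (fun ζ hζ => hpos ζ hζ k (by omega)) h)
  have hlt : ∀ i j, i < j → j < n + 2 → e i < e j := fun i j hij hj =>
    (hstep i (by omega)).trans_le (he _ _ hij hj)
  obtain ⟨a, ha, hexp⟩ := exists_alternating_gap_expansion hlt Z hpos (by omega)
  have hdvd : ∏ ζ ∈ Z, (X - C ζ) ∣ critPoly l e n := by
    refine Finset.prod_dvd_of_coprime (fun x _ y _ hxy => ?_) fun ζ hζ => dvd_iff_isRoot.2 (h ζ hζ)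
    exact isCoprime_X_sub_C_of_isUnit_sub (sub_ne_zero.2 hxy).isUnit
  obtain ⟨q, hq⟩ := hdvd
  have hq0 : q ≠ 0 := fun h0 => hne (by rw [hq, h0, mul_zero])
  have hmonic : (∏ ζ ∈ Z, (X - C ζ)).Monic := monic_prod_of_monic _ _ fun ζ _ => monic_X_sub_C ζ
  have hqd : q.natDegree = 0 := by
    have h1 := natDegree_critPoly_le l e n
    rw [hq, hmonic.natDegree_mul' hq0, natDegree_prod_of_monic _ _ fun ζ _ => monic_X_sub_C ζ] at h1
    simp [hZ] at h1
    exact h1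
  obtain ⟨c, rfl⟩ := natDegree_eq_zero.1 hqd
  have hc : c ≠ 0 := by simpa using hq0
  have hcoef := eq_zero_of_sum_gapPoly_eq_zero (n := n) hlt
    (x := fun k => (∑ i ∈ range (k + 1), l i) * (e k - e (k + 1)) - c * a k) (by
      have h2 : critPoly l e n = ∑ k ∈ range (n + 1), C (c * a k) * gapPoly e (n + 2) k (k + 2) := by
        rw [hq, hexp, hZ, sum_mul]
        refine sum_congr rfl fun k _ => ?_
        rw [show k + (n + 2) - n = k + 2 by omega, C_mul]
        ring
      simp only [C_sub, sub_mul, sum_sub_distrib]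
      rw [← h2, critPoly, sub_self])
  intro k hk
  have h1 : (∑ i ∈ range (k + 1), l i) * (e k - e (k + 1)) = c * a k :=
    sub_eq_zero.1 (hcoef k hk.le)
  have h2 : (∑ i ∈ range (k + 2), l i) * (e (k + 1) - e (k + 2)) = c * a (k + 1) :=
    sub_eq_zero.1 (hcoef (k + 1) hk)
  have h3 : 0 < (e k - e (k + 1)) * (e (k + 1) - e (k + 2)) :=
    mul_pos_of_neg_of_neg (sub_neg.2 (hstep k (by omega))) (sub_neg.2 (hstep (k + 1) (by omega)))
  have h4 : a k * a (k + 1) < 0 := by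
    have h5 := mul_pos (ha k (by omega)) (ha (k + 1) (by omega))
    have h6 : (-1 : ℝ) ^ k * (-1) ^ k = 1 := by rw [← mul_pow]; simp
    rw [pow_succ] at h5
    have : (-1 : ℝ) ^ k * a k * ((-1) ^ k * -1 * a (k + 1)) =
        -((-1 : ℝ) ^ k * (-1) ^ k * (a k * a (k + 1))) := by ring
    rw [this, h6, one_mul] at h5
    linarith
  have h7 : (∑ i ∈ range (k + 1), l i) * (∑ i ∈ range (k + 2), l i) *
      ((e k - e (k + 1)) * (e (k + 1) - e (k + 2))) < 0 := by
    have : (∑ i ∈ range (k + 1), l i) * (∑ i ∈ range (k + 2), l i) *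
      ((e k - e (k + 1)) * (e (k + 1) - e (k + 2))) = c ^ 2 * (a k * a (k + 1)) := by
      calc _ = ((∑ i ∈ range (k + 1), l i) * (e k - e (k + 1))) *
          ((∑ i ∈ range (k + 2), l i) * (e (k + 1) - e (k + 2))) := by ring
        _ = _ := by rw [h1, h2]; ring
    rw [this]
    exact mul_neg_of_pos_of_neg (by positivity) h4
  exact neg_of_mul_neg_left h7 h3.le

end

/-! ### The logarithmic equation and Rolle's theorem -/

section

open Polynomial

/-- Rolle's theorem for a finite set of zeros: the derivative vanishes at one point fewer at least,
and these points can be taken outside of the given set. -/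
theorem exists_finset_deriv_zeros {f f' : ℝ → ℝ} {D : Set ℝ} (hD : D.OrdConnected)
    (hf : ∀ x ∈ D, HasDerivAt f (f' x) x) (Y : Finset ℝ) (hY : ∀ y ∈ Y, y ∈ D ∧ f y = 0) :
    ∃ Z : Finset ℝ, (∀ z ∈ Z, z ∈ D ∧ f' z = 0) ∧ Disjoint Z Y ∧ #Y ≤ #Z + 1 ∧
      ∀ z ∈ Z, ∃ y ∈ Y, z < y := by
  induction Y using Finset.induction_on_max with
  | empty => exact ⟨∅, by simp⟩
  | insert a s hs ih =>
    obtain ⟨Z, hZ, hdisj, hcard, hlt⟩ := ih fun y hy => hY y (mem_insert_of_mem hy)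
    have has : a ∉ s := fun h => lt_irrefl _ (hs a h)
    rcases s.eq_empty_or_nonempty with rfl | hne
    · exact ⟨∅, by simp⟩
    · set b := s.max' hne with hb
      have hbs : b ∈ s := s.max'_mem hne
      have hba : b < a := hs b hbs
      have hbD := hY b (mem_insert_of_mem hbs)
      have haD := hY a (mem_insert_self _ _)
      have hIcc : Set.Icc b a ⊆ D := hD.out hbD.1 haD.1
      obtain ⟨ζ, hζ, hζ0⟩ := exists_hasDerivAt_eq_zero hba
        (fun x hx => (hf x (hIcc hx)).continuousAt.continuousWithinAt)
        (by rw [hbD.2, haD.2]) (fun x hx => hf x (hIcc (Set.Ioo_subset_Icc_self hx)))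
      have hZb : ∀ z ∈ Z, z < b := fun z hz => by
        obtain ⟨y, hy, hzy⟩ := hlt z hz
        exact hzy.trans_le (s.le_max' y hy)
      have hζZ : ζ ∉ Z := fun h => lt_asymm (hZb ζ h) hζ.1
      refine ⟨insert ζ Z, ?_, ?_, ?_, ?_⟩
      · intro z hz
        rcases mem_insert.1 hz with rfl | hz
        · exact ⟨hIcc (Set.Ioo_subset_Icc_self hζ), hζ0⟩
        · exact hZ z hz
      · rw [disjoint_insert_left, disjoint_insert_right]
        refine ⟨fun h => ?_, fun h => lt_asymm (hZb a h) hba, hdisj⟩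
        rcases mem_insert.1 h with h | h
        · exact hζ.2.ne h
        · exact absurd (s.le_max' ζ h) (not_le.2 hζ.1)
      · rw [card_insert_of_notMem has, card_insert_of_notMem hζZ]
        omega
      · intro z hz
        refine ⟨a, mem_insert_self _ _, ?_⟩
        rcases mem_insert.1 hz with rfl | hz
        · exact hζ.2
        · exact (hZb z hz).trans hba

/-- The interval of those `t` at which the first `N` linear factors `1 + e j * t` are positive. -/
def posInterval (e : ℕ → ℝ) (N : ℕ) : Set ℝ := {t | ∀ j < N, 0 < 1 + e j * t}

/-- The logarithm `∑ λᵢ log (1 + eᵢ t)` of the Gale dual equation. -/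
noncomputable def logSum (l e : ℕ → ℝ) (N : ℕ) (t : ℝ) : ℝ :=
  ∑ i ∈ range N, l i * Real.log (1 + e i * t)

/-- The derivative of `logSum`. -/
noncomputable def logSumDeriv (l e : ℕ → ℝ) (N : ℕ) (t : ℝ) : ℝ :=
  ∑ i ∈ range N, l i * (e i / (1 + e i * t))

theorem ordConnected_posInterval (e : ℕ → ℝ) (N : ℕ) : (posInterval e N).OrdConnected := by
  refine ⟨fun x hx y hy t ht j hj => ?_⟩
  have h1 := hx j hj
  have h2 := hy j hj
  rcases le_total 0 (e j) with h | h
  · have := mul_le_mul_of_nonneg_left ht.1 h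
    linarith
  · have := mul_le_mul_of_nonpos_left ht.2 h
    linarith

theorem hasDerivAt_logSum (l e : ℕ → ℝ) {N : ℕ} {t : ℝ} (ht : t ∈ posInterval e N) :
    HasDerivAt (logSum l e N) (logSumDeriv l e N t) t := by
  unfold logSum logSumDeriv
  refine HasDerivAt.fun_sum fun i hi => ?_
  have h1 : HasDerivAt (fun t => 1 + e i * t) (e i) t := by
    simpa using ((hasDerivAt_id t).const_mul (e i)).const_add 1
  exact (h1.log (ht i (mem_range.1 hi)).ne').const_mul (l i)

theorem eval_critPoly_eq_zero_iff {l e : ℕ → ℝ} {n : ℕ} (hl : ∑ i ∈ range (n + 2), l i = 0) {t : ℝ}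
    (ht : t ∈ posInterval e (n + 2)) :
    (critPoly l e n).eval t = 0 ↔ logSumDeriv l e (n + 2) t = 0 := by
  rw [eval_critPoly hl ht, logSumDeriv, mul_eq_zero, or_iff_left]
  exact prod_ne_zero_iff.2 fun j hj => (ht j (mem_range.1 hj)).ne'

theorem logSumDeriv_eq_zero_of_card_lt {l e : ℕ → ℝ} {n : ℕ}
    (hl : ∑ i ∈ range (n + 2), l i = 0) {Z : Finset ℝ} (hZ : n < #Z)
    (h : ∀ z ∈ Z, z ∈ posInterval e (n + 2) ∧ logSumDeriv l e (n + 2) z = 0) {t : ℝ}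
    (ht : t ∈ posInterval e (n + 2)) : logSumDeriv l e (n + 2) t = 0 := by
  rw [← eval_critPoly_eq_zero_iff hl ht, critPoly_eq_zero_of_card_lt hZ, eval_zero]
  exact fun z hz => (eval_critPoly_eq_zero_iff hl (h z hz).1).2 (h z hz).2

theorem exists_finset_logSumDeriv_zeros {l e : ℕ → ℝ} {N : ℕ} {K : ℝ} {Y : Finset ℝ}
    (hY : ∀ y ∈ Y, y ∈ posInterval e N ∧ logSum l e N y = K) :
    ∃ Z : Finset ℝ, (∀ z ∈ Z, z ∈ posInterval e N ∧ logSumDeriv l e N z = 0) ∧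
      Disjoint Z Y ∧ #Y ≤ #Z + 1 := by
  obtain ⟨Z, h1, h2, h3, -⟩ := exists_finset_deriv_zeros (f := fun t => logSum l e N t - K)
    (ordConnected_posInterval e N) (fun t ht => (hasDerivAt_logSum l e ht).sub_const K) Y
    fun y hy => ⟨(hY y hy).1, sub_eq_zero.2 (hY y hy).2⟩
  exact ⟨Z, h1, h2, h3⟩

/-- A double root would be a zero of the derivative in addition to those given by Rolle's theorem. -/
theorem logSumDeriv_eq_zero_of_double_root {l e : ℕ → ℝ} {n : ℕ} {K : ℝ}
    (hl : ∑ i ∈ range (n + 2), l i = 0) {Y : Finset ℝ} (hY : n + 1 ≤ #Y)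
    (h : ∀ y ∈ Y, y ∈ posInterval e (n + 2) ∧ logSum l e (n + 2) y = K) {y : ℝ} (hy : y ∈ Y)
    (hy0 : logSumDeriv l e (n + 2) y = 0) {t : ℝ} (ht : t ∈ posInterval e (n + 2)) :
    logSumDeriv l e (n + 2) t = 0 := by
  obtain ⟨Z, hZ, hdisj, hcard⟩ := exists_finset_logSumDeriv_zeros h
  refine logSumDeriv_eq_zero_of_card_lt hl (Z := insert y Z) ?_ ?_ ht
  · rw [card_insert_of_notMem fun hyZ => disjoint_left.1 hdisj hyZ hy]
    omega
  · intro z hz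
    rcases mem_insert.1 hz with rfl | hz
    · exact ⟨(h z hy).1, hy0⟩
    · exact hZ z hz

theorem logSumDeriv_eq_zero_of_card_roots {l e : ℕ → ℝ} {n : ℕ} {K : ℝ}
    (hl : ∑ i ∈ range (n + 2), l i = 0) {Y : Finset ℝ} (hY : n + 1 < #Y)
    (h : ∀ y ∈ Y, y ∈ posInterval e (n + 2) ∧ logSum l e (n + 2) y = K) {t : ℝ}
    (ht : t ∈ posInterval e (n + 2)) : logSumDeriv l e (n + 2) t = 0 := by
  obtain ⟨Z, hZ, -, hcard⟩ := exists_finset_logSumDeriv_zeros h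
  exact logSumDeriv_eq_zero_of_card_lt hl (by omega) hZ ht

theorem partialSum_alternate_of_card_roots {l e : ℕ → ℝ} {n : ℕ} (hn : 1 ≤ n) {K : ℝ}
    (hl : ∑ i ∈ range (n + 2), l i = 0)
    (he : ∀ i j, i ≤ j → j < n + 2 → e i ≤ e j) {Y : Finset ℝ} (hY : n + 1 ≤ #Y)
    (h : ∀ y ∈ Y, y ∈ posInterval e (n + 2) ∧ logSum l e (n + 2) y = K) {t : ℝ}
    (ht : t ∈ posInterval e (n + 2)) (ht0 : logSumDeriv l e (n + 2) t ≠ 0) :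
    ∀ k < n, (∑ i ∈ range (k + 1), l i) * (∑ i ∈ range (k + 2), l i) < 0 := by
  obtain ⟨Z', hZ', -, hcard⟩ := exists_finset_logSumDeriv_zeros h
  obtain ⟨Z, hZZ', hZ⟩ := exists_subset_card_eq (show n ≤ #Z' by omega)
  refine partialSum_mul_partialSum_neg hn he hZ (fun ζ hζ => (hZ' ζ (hZZ' hζ)).1)
    (fun ζ hζ => (eval_critPoly_eq_zero_iff hl (hZ' ζ (hZZ' hζ)).1).2 (hZ' ζ (hZZ' hζ)).2) ?_
  intro h0
  exact ht0 ((eval_critPoly_eq_zero_iff hl ht).1 (by rw [h0, eval_zero]))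

end

/-! ### Linear algebra of circuits -/

/-- `l` is an affine relation on the points `w i`, and every affine relation is a multiple of it. -/
def IsUniqueRelation {n : ℕ} (w : Fin (n + 2) → (Fin n → ℝ)) (l : Fin (n + 2) → ℝ) : Prop :=
  IsAffineRelation w l ∧
    ∀ l' : Fin (n + 2) → ℝ, ∑ i, l' i = 0 → ∑ i, l' i • w i = 0 → ∃ c : ℝ, l' = c • l

/-- By minimality, a relation on a circuit with one coefficient zero is trivial. -/
theorem IsCircuit.eq_zero_of_apply_eq_zero {n : ℕ} {W : Set (Fin n → ℝ)} (hW : IsCircuit W)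
    (w : Fin (n + 2) ≃ W) {l : Fin (n + 2) → ℝ} (h1 : ∑ i, l i = 0)
    (h2 : ∑ i, l i • (w i : Fin n → ℝ) = 0) {i : Fin (n + 2)} (hi : l i = 0) : l = 0 := by
  have hS : W \ {(w i : Fin n → ℝ)} ⊂ W :=
    Set.sdiff_singleton_ssubset.2 (w i).2
  have hind := hW.2.2 _ hS
  let φ : {j // j ≠ i} ↪ (W \ {(w i : Fin n → ℝ)} : Set (Fin n → ℝ)) :=
    ⟨fun j => ⟨w j, (w j).2, fun h => j.2 (w.injective (Subtype.ext h))⟩, fun a b hab => by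
      have h := Subtype.ext_iff.1 hab
      exact Subtype.ext (w.injective (Subtype.ext h))⟩
  have hind' := affineIndependent_iff.1 (hind.comp_embedding φ) univ (fun j => l j)
  have e1 : ∑ j : {j // j ≠ i}, l j = 0 := by
    rw [← Finset.sum_subtype (univ.erase i) (by simp) l, sum_erase _ hi, h1]
  have e2 : ∑ j : {j // j ≠ i}, l j • (w j : Fin n → ℝ) = 0 := by
    rw [← Finset.sum_subtype (univ.erase i) (by simp) fun j => l j • (w j : Fin n → ℝ),
      sum_erase _ (by rw [hi, zero_smul]), h2]
  have := hind' e1 e2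
  funext j
  rcases eq_or_ne j i with rfl | hj
  · exact hi
  · exact this ⟨j, hj⟩ (mem_univ _)

theorem IsCircuit.isUniqueRelation {n : ℕ} {W : Set (Fin n → ℝ)} (hW : IsCircuit W)
    (w : Fin (n + 2) ≃ W) {l : Fin (n + 2) → ℝ}
    (hl : IsAffineRelation (fun i => (w i : Fin n → ℝ)) l) :
    IsUniqueRelation (fun i => (w i : Fin n → ℝ)) l := by
  refine ⟨hl, fun l' h1 h2 => ⟨l' 0 / l 0, ?_⟩⟩
  have h0 : l 0 ≠ 0 := fun h => hl.1 (hW.eq_zero_of_apply_eq_zero w hl.2.1 hl.2.2 h)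
  refine sub_eq_zero.1 (hW.eq_zero_of_apply_eq_zero w (i := 0) ?_ ?_ ?_)
  · simp [sum_sub_distrib, ← mul_sum, h1, hl.2.1]
  · simp only [Pi.sub_apply, Pi.smul_apply, sub_smul, smul_assoc, sum_sub_distrib, ← smul_sum, h2,
      hl.2.2, smul_zero, sub_zero]
  · simp [h0]

theorem IsCircuit.exists_isAffineRelation {n : ℕ} {W : Set (Fin n → ℝ)} (hW : IsCircuit W)
    (w : Fin (n + 2) ≃ W) : ∃ l, IsAffineRelation (fun i => (w i : Fin n → ℝ)) l := by
  have h : ¬ AffineIndependent ℝ (fun i => (w i : Fin n → ℝ)) := fun h =>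
    hW.2.1 ((affineIndependent_equiv w).1 h)
  rw [affineIndependent_iff] at h
  push Not at h
  obtain ⟨s, l, h1, h2, i, his, hi⟩ := h
  refine ⟨fun j => if j ∈ s then l j else 0, fun h0 => hi ?_, ?_, ?_⟩
  · simpa [his] using congrFun h0 i
  · simpa [sum_ite_mem] using h1
  · simpa [ite_smul, sum_ite_mem] using h2

theorem IsCircuit.exists_equiv {n : ℕ} {W : Set (Fin n → ℝ)} (hW : IsCircuit W) :
    Nonempty (Fin (n + 2) ≃ W) := by
  have hfin : W.Finite := Set.finite_of_encard_eq_coe (k := n + 2) (by simpa using hW.1)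
  have := hfin.fintype
  refine ⟨(Fintype.equivFinOfCardEq ?_).symm⟩
  have h := hW.1
  rw [Set.encard_eq_coe_toFinset_card, Set.toFinset_card] at h
  exact_mod_cast h

/-- The affine functions `w ↦ a + ⟨w, v⟩`, restricted to the points `w i`. -/
def affineEval {n : ℕ} (w : Fin (n + 2) → (Fin n → ℝ)) :
    ℝ × (Fin n → ℝ) →ₗ[ℝ] (Fin (n + 2) → ℝ) where
  toFun p i := p.1 + w i ⬝ᵥ p.2
  map_add' p q := by
    funext i
    simp only [Prod.fst_add, Prod.snd_add, dotProduct_add, Pi.add_apply]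
    ring
  map_smul' c p := by
    funext i
    simp only [Prod.smul_fst, Prod.smul_snd, dotProduct_smul, Pi.smul_apply, smul_eq_mul,
      RingHom.id_apply]
    ring

theorem sum_mul_affine {n : ℕ} {w : Fin (n + 2) → (Fin n → ℝ)} {l : Fin (n + 2) → ℝ}
    (h1 : ∑ i, l i = 0) (h2 : ∑ i, l i • w i = 0) (a : ℝ) (v : Fin n → ℝ) :
    ∑ i, l i * (a + w i ⬝ᵥ v) = 0 := by
  have h3 : ∑ i, l i * (w i ⬝ᵥ v) = 0 := by
    have := congrArg (fun x => x ⬝ᵥ v) h2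
    simpa [sum_dotProduct, smul_dotProduct] using this
  simp only [mul_add, sum_add_distrib, ← sum_mul, h1, h3]
  ring

/-- A functional that vanishes on the restricted affine functions is an affine relation, so a multiple
of `l`. -/
theorem IsUniqueRelation.range_affineEval {n : ℕ} {w : Fin (n + 2) → (Fin n → ℝ)}
    {l : Fin (n + 2) → ℝ} (h : IsUniqueRelation w l) :
    LinearMap.range (affineEval w) = LinearMap.ker (Fintype.linearCombination ℝ l) := by
  apply le_antisymm
  · rintro _ ⟨p, rfl⟩
    have := sum_mul_affine h.1.2.1 h.1.2.2 p.1 p.2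
    rw [LinearMap.mem_ker, Fintype.linearCombination_apply]
    rw [← this]
    exact sum_congr rfl fun i _ => by simp [affineEval, mul_comm]
  · intro y hy
    by_contra hnot
    obtain ⟨f, hfy, hf⟩ := Submodule.exists_le_ker_of_notMem hnot
    let l' : Fin (n + 2) → ℝ := fun i => f (Pi.single i 1)
    have hfl : ∀ x, f x = ∑ i, x i * l' i := fun x => by
      rw [LinearMap.pi_apply_eq_sum_univ f x]
      refine sum_congr rfl fun i _ => ?_
      rw [smul_eq_mul]
      congr 2
      funext j
      simp [Pi.single_apply, eq_comm]
    have hz : ∀ p : ℝ × (Fin n → ℝ), ∑ i, (p.1 + w i ⬝ᵥ p.2) * l' i = 0 := fun p => by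
      have := hf (LinearMap.mem_range_self (affineEval w) p)
      rw [LinearMap.mem_ker, hfl] at this
      exact this
    obtain ⟨c, hc⟩ := h.2 l' (by simpa using hz (1, 0)) (by
      funext j
      simpa [mul_comm] using hz (0, Pi.single j 1))
    apply hfy
    rw [LinearMap.mem_ker, Fintype.linearCombination_apply] at hy
    rw [hfl, hc]
    have : ∑ i, y i * (c • l) i = c * ∑ i, y i • l i := by
      rw [mul_sum]
      exact sum_congr rfl fun i _ => by simp; ring
    rw [this, hy, mul_zero]

theorem IsUniqueRelation.exists_affine {n : ℕ} {w : Fin (n + 2) → (Fin n → ℝ)}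
    {l : Fin (n + 2) → ℝ} (h : IsUniqueRelation w l) {y : Fin (n + 2) → ℝ}
    (hy : ∑ i, l i * y i = 0) : ∃ (a : ℝ) (v : Fin n → ℝ), ∀ i, y i = a + w i ⬝ᵥ v := by
  have : y ∈ LinearMap.range (affineEval w) := by
    rw [h.range_affineEval, LinearMap.mem_ker, Fintype.linearCombination_apply, ← hy]
    exact sum_congr rfl fun i _ => by simp [mul_comm]
  obtain ⟨p, rfl⟩ := this
  exact ⟨p.1, p.2, fun i => rfl⟩

theorem IsUniqueRelation.eq_zero_of_affine_eq_zero {n : ℕ} {w : Fin (n + 2) → (Fin n → ℝ)}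
    {l : Fin (n + 2) → ℝ} (h : IsUniqueRelation w l) {a : ℝ} {v : Fin n → ℝ}
    (hv : ∀ i, a + w i ⬝ᵥ v = 0) : v = 0 := by
  have h1 := LinearMap.finrank_range_add_finrank_ker (affineEval w)
  have h2 := LinearMap.finrank_range_add_finrank_ker (Fintype.linearCombination ℝ l)
  have h3 : Module.finrank ℝ (LinearMap.range (Fintype.linearCombination ℝ l)) ≤ 1 := by
    simpa using Submodule.finrank_le (LinearMap.range (Fintype.linearCombination ℝ l))
  rw [h.range_affineEval] at h1
  simp only [Module.finrank_prod, Module.finrank_self, Module.finrank_fin_fun] at h1 h2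
  have h4 : LinearMap.ker (affineEval w) = ⊥ := Submodule.finrank_eq_zero.1 (by omega)
  have h5 : (a, v) ∈ LinearMap.ker (affineEval w) := by
    rw [LinearMap.mem_ker]
    exact funext hv
  rw [h4, Submodule.mem_bot] at h5
  exact congrArg Prod.snd h5

/-! ### Systems and their Jacobians -/

theorem monom_eq_exp {n : ℕ} (u : Fin n → ℝ) {z : Fin n → ℝ} (hz : ∀ j, 0 < z j) :
    monom u z = Real.exp (u ⬝ᵥ fun j => Real.log (z j)) := by
  rw [monom, dotProduct, Real.exp_sum]
  exact prod_congr rfl fun j _ => by rw [Real.rpow_def_of_pos (hz j), mul_comm]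

theorem monom_pos {n : ℕ} (u : Fin n → ℝ) {z : Fin n → ℝ} (hz : ∀ j, 0 < z j) :
    0 < monom u z :=
  prod_pos fun j _ => Real.rpow_pos_of_pos (hz j) _

/-- The coefficient matrix of a system, for a given numbering of the points of its support. -/
def coeffMatrix {n N : ℕ} (f : Fin n → GenPoly n) (w : Fin N → (Fin n → ℝ)) :
    Matrix (Fin n) (Fin N) ℝ :=
  Matrix.of fun j i => f j (w i)

/-- The vector of the monomials with exponents `w i`. -/
noncomputable def monomVec {n N : ℕ} (w : Fin N → (Fin n → ℝ)) (z : Fin n → ℝ) : Fin N → ℝ :=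
  fun i => monom (w i) z

open Matrix in
theorem evalSystem_eq_mulVec {n N : ℕ} {f : Fin n → GenPoly n} {W : Set (Fin n → ℝ)}
    (hf : systemSupport f ⊆ W) (w : Fin N ≃ W) (z : Fin n → ℝ) :
    evalSystem f z =
      coeffMatrix f (fun i => (w i : Fin n → ℝ)) *ᵥ monomVec (fun i => (w i : Fin n → ℝ)) z := by
  funext j
  let φ : Fin N ↪ (Fin n → ℝ) := w.toEmbedding.trans (Function.Embedding.subtype _)
  have hsub : (f j).support ⊆ univ.map φ := by
    intro u hu
    have huW : u ∈ W := hf (Set.mem_iUnion.2 ⟨j, hu⟩)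
    exact mem_map.2 ⟨w.symm ⟨u, huW⟩, mem_univ _, by simp [φ]⟩
  rw [evalSystem, GenPoly.eval, Finsupp.sum_of_support_subset _ hsub _ (by simp), sum_map]
  rfl

theorem hasFDerivAt_monom {n : ℕ} (u : Fin n → ℝ) {z : Fin n → ℝ} (hz : ∀ j, 0 < z j) :
    HasFDerivAt (monom u)
      (monom u z • ∑ j, u j • (z j)⁻¹ • ContinuousLinearMap.proj (R := ℝ) (φ := fun _ => ℝ) j)
      z := by
  have h1 : HasFDerivAt (fun z : Fin n → ℝ => ∑ j, u j * Real.log (z j))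
      (∑ j, u j • (z j)⁻¹ • ContinuousLinearMap.proj (R := ℝ) (φ := fun _ => ℝ) j) z :=
    HasFDerivAt.fun_sum fun j _ => ((hasFDerivAt_apply j z).log (hz j).ne').const_mul (u j)
  have h2 := h1.exp
  have h3 : (fun z : Fin n → ℝ => Real.exp (∑ j, u j * Real.log (z j))) =ᶠ[nhds z] monom u := by
    have : ∀ᶠ x in nhds z, ∀ j, 0 < x j := Filter.eventually_all.2 fun j =>
      (continuous_apply j).continuousAt.eventually (lt_mem_nhds (hz j))
    filter_upwards [this] with x hx
    rw [monom_eq_exp u hx]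
    rfl
  rw [monom_eq_exp u hz]
  exact h2.congr_of_eventuallyEq h3.symm

open Matrix in
theorem fderiv_evalSystem_apply {n N : ℕ} {f : Fin n → GenPoly n} {W : Set (Fin n → ℝ)}
    (hf : systemSupport f ⊆ W) (w : Fin N ≃ W) {z : Fin n → ℝ} (hz : ∀ j, 0 < z j)
    (v : Fin n → ℝ) :
    fderiv ℝ (evalSystem f) z v =
      coeffMatrix f (fun i => (w i : Fin n → ℝ)) *ᵥ
        fun i => monom (w i) z * ((w i : Fin n → ℝ) ⬝ᵥ fun j => v j / z j) := by
  have h1 : HasFDerivAt (monomVec fun i => (w i : Fin n → ℝ)) _ z :=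
    hasFDerivAt_pi.2 fun i => hasFDerivAt_monom (w i : Fin n → ℝ) hz
  have h2 := ((coeffMatrix f fun i => (w i : Fin n → ℝ)).mulVecLin.toContinuousLinearMap
    |>.hasFDerivAt).comp z h1
  have h3 : evalSystem f = (coeffMatrix f fun i => (w i : Fin n → ℝ)).mulVecLin.toContinuousLinearMap
      ∘ monomVec fun i => (w i : Fin n → ℝ) := funext fun z => evalSystem_eq_mulVec hf w z
  rw [h3, h2.fderiv]
  simp only [ContinuousLinearMap.comp_apply, LinearMap.coe_toContinuousLinearMap',
    mulVecLin_apply]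
  congr 1
  funext i
  simp [dotProduct, div_eq_inv_mul]

theorem det_ne_zero_iff_forall_apply_eq_zero {n : ℕ} (D : (Fin n → ℝ) →L[ℝ] (Fin n → ℝ)) :
    D.det ≠ 0 ↔ ∀ v, D v = 0 → v = 0 := by
  rw [ContinuousLinearMap.det, Ne, LinearMap.det_eq_zero_iff_ker_ne_bot, not_not,
    LinearMap.ker_eq_bot']
  rfl

open Matrix in
/-- Non-degeneracy in logarithmic coordinates, where the derivative of the monomial map is linear in
the exponents. -/
theorem mem_nondegPosSolutions_iff {n N : ℕ} {f : Fin n → GenPoly n} {W : Set (Fin n → ℝ)}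
    (hf : systemSupport f ⊆ W) (w : Fin N ≃ W) {z : Fin n → ℝ} :
    z ∈ nondegPosSolutions f ↔ (∀ j, 0 < z j) ∧
      coeffMatrix f (fun i => (w i : Fin n → ℝ)) *ᵥ monomVec (fun i => (w i : Fin n → ℝ)) z = 0 ∧
      ∀ y : Fin n → ℝ, coeffMatrix f (fun i => (w i : Fin n → ℝ)) *ᵥ
        (fun i => monom (w i) z * ((w i : Fin n → ℝ) ⬝ᵥ y)) = 0 → y = 0 := by
  rw [nondegPosSolutions, Set.mem_ofPred_eq]
  refine and_congr_right fun hz => ?_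
  rw [evalSystem_eq_mulVec hf w, det_ne_zero_iff_forall_apply_eq_zero]
  refine and_congr_right fun _ => ⟨fun h y hy => ?_, fun h v hv => ?_⟩
  · have h1 := h (fun j => z j * y j) (by
      rw [fderiv_evalSystem_apply hf w hz, ← hy]
      congr! 5 with i j
      exact mul_div_cancel_left₀ _ (hz j).ne')
    funext j
    exact (mul_eq_zero.1 (congrFun h1 j)).resolve_left (hz j).ne'
  · rw [fderiv_evalSystem_apply hf w hz] at hv
    have h1 := h _ hv
    funext j
    exact (div_eq_zero_iff.1 (congrFun h1 j)).resolve_right (hz j).ne'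

/-! ### Gale duality for a given system -/

section

open Matrix

/-- A surjective linear map with two-dimensional kernel: the vectors of the kernel with coordinate
sum `1` lie on a line. -/
theorem exists_direction_of_surjective {n : ℕ} {A : Matrix (Fin n) (Fin (n + 2)) ℝ}
    (hA : Function.Surjective A.mulVecLin) {u : Fin (n + 2) → ℝ} (hu : A *ᵥ u = 0)
    (hu1 : ∑ i, u i = 1) :
    ∃ d : Fin (n + 2) → ℝ, A *ᵥ d = 0 ∧ ∑ i, d i = 0 ∧
      ∀ x, A *ᵥ x = 0 → ∑ i, x i = 1 → ∃ t : ℝ, x = u + t • d := by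
  let S : (Fin (n + 2) → ℝ) →ₗ[ℝ] ℝ := Fintype.linearCombination ℝ (fun _ => (1 : ℝ))
  have hS : ∀ x, S x = ∑ i, x i := fun x => by simp [S, Fintype.linearCombination_apply]
  have h1 := LinearMap.finrank_range_add_finrank_ker A.mulVecLin
  rw [LinearMap.range_eq_top.2 hA, finrank_top] at h1
  simp only [Module.finrank_fin_fun] at h1
  have hlt : LinearMap.ker A.mulVecLin ⊓ LinearMap.ker S < LinearMap.ker A.mulVecLin := by
    refine lt_of_le_of_ne inf_le_left fun h => ?_
    have h2 : u ∈ LinearMap.ker A.mulVecLin ⊓ LinearMap.ker S := by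
      rw [h]
      exact hu
    have h3 : S u = 0 := h2.2
    rw [hS, hu1] at h3
    exact one_ne_zero h3
  have h2 := Submodule.finrank_lt_finrank_of_lt hlt
  obtain ⟨d, hd⟩ := finrank_le_one_iff.1
    (show Module.finrank ℝ ↥(LinearMap.ker A.mulVecLin ⊓ LinearMap.ker S) ≤ 1 by omega)
  refine ⟨d, d.2.1, ?_, fun x hx hx1 => ?_⟩
  · rw [← hS]
    exact d.2.2
  · have hmem : x - u ∈ LinearMap.ker A.mulVecLin ⊓ LinearMap.ker S := by
      refine ⟨?_, ?_⟩
      · rw [SetLike.mem_coe, LinearMap.mem_ker, map_sub]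
        simp [hx, hu]
      · rw [SetLike.mem_coe, LinearMap.mem_ker, map_sub, hS, hS, hx1, hu1, sub_self]
    obtain ⟨t, ht⟩ := hd ⟨x - u, hmem⟩
    refine ⟨t, ?_⟩
    have := congrArg Subtype.val ht
    simp only [Submodule.coe_smul] at this
    rw [this, add_sub_cancel]

/-- Gale duality. Non-degenerate positive solutions correspond to the positive vectors `x` with
coordinate sum `1` in the kernel of the coefficient matrix that satisfy `∑ λᵢ log xᵢ = 0`. As
the kernel is a plane, these vectors lie on a line `xᵢ = uᵢ (1 + eᵢ t)` through one of them, which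
has parameter `t = 0`; it is non-degenerate, so `∑ λᵢ eᵢ ≠ 0`. -/
theorem exists_gale_dual {n : ℕ} {f : Fin n → GenPoly n} {W : Set (Fin n → ℝ)}
    (hf : systemSupport f ⊆ W) (w : Fin (n + 2) ≃ W) {l : Fin (n + 2) → ℝ}
    (hl : IsUniqueRelation (fun i => (w i : Fin n → ℝ)) l) {Z : Finset (Fin n → ℝ)}
    (hZ : ∀ z ∈ Z, z ∈ nondegPosSolutions f) (hZ2 : 1 < #Z) :
    ∃ (e : Fin (n + 2) → ℝ) (Y : Finset ℝ), #Y = #Z ∧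
      (∀ t ∈ Y, (∀ i, 0 < 1 + e i * t) ∧ ∑ i, l i * Real.log (1 + e i * t) = 0) ∧
      ∑ i, l i * e i ≠ 0 := by
  simp only [mem_nondegPosSolutions_iff hf w] at hZ
  set A := coeffMatrix f (fun i => (w i : Fin n → ℝ)) with hAdef
  set w' : Fin (n + 2) → (Fin n → ℝ) := fun i => (w i : Fin n → ℝ) with hw'
  let s : (Fin n → ℝ) → ℝ := fun z => ∑ i, monom (w' i) z
  let ν : (Fin n → ℝ) → (Fin (n + 2) → ℝ) := fun z => (s z)⁻¹ • monomVec w' z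
  have hs : ∀ z ∈ Z, 0 < s z := fun z hz => sum_pos (fun i _ => monom_pos _ (hZ z hz).1) univ_nonempty
  have hνA : ∀ z ∈ Z, A *ᵥ ν z = 0 := fun z hz => by
    rw [mulVec_smul, (hZ z hz).2.1, smul_zero]
  have hν1 : ∀ z ∈ Z, ∑ i, ν z i = 1 := fun z hz => by
    simp only [ν, Pi.smul_apply, smul_eq_mul, ← mul_sum]
    exact inv_mul_cancel₀ (hs z hz).ne'
  have hνpos : ∀ z ∈ Z, ∀ i, 0 < ν z i := fun z hz i =>
    mul_pos (inv_pos.2 (hs z hz)) (monom_pos _ (hZ z hz).1)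
  have hνlog : ∀ z ∈ Z, ∀ i, Real.log (ν z i) =
      -Real.log (s z) + w' i ⬝ᵥ fun j => Real.log (z j) := fun z hz i => by
    change Real.log ((s z)⁻¹ * monom (w' i) z) = _
    rw [Real.log_mul (inv_pos.2 (hs z hz)).ne' (monom_pos _ (hZ z hz).1).ne', Real.log_inv,
      monom_eq_exp _ (hZ z hz).1, Real.log_exp]
  have hνinj : ∀ z ∈ Z, ∀ z' ∈ Z, ν z = ν z' → z = z' := fun z hz z' hz' h => by
    have h1 := hl.eq_zero_of_affine_eq_zero (a := -Real.log (s z) + Real.log (s z'))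
      (v := (fun j => Real.log (z j)) - fun j => Real.log (z' j)) fun i => by
        have h2 := hνlog z hz i
        have h3 := hνlog z' hz' i
        rw [h] at h2
        rw [dotProduct_sub]
        linarith
    funext j
    exact Real.log_injOn_pos ((hZ z hz).1 j) ((hZ z' hz').1 j) (sub_eq_zero.1 (congrFun h1 j))
  obtain ⟨z₀, hz₀, z₁, hz₁, hne⟩ := one_lt_card.1 hZ2
  have hsurj : Function.Surjective A.mulVecLin := by
    let D : (Fin n → ℝ) →ₗ[ℝ] (Fin n → ℝ) :=
      A.mulVecLin ∘ₗ LinearMap.pi fun i => monom (w' i) z₀ • dotProductBilin ℝ ℝ (w' i)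
    have hD : Function.Injective D := (injective_iff_map_eq_zero D).2 fun y hy =>
      (hZ z₀ hz₀).2.2 y hy
    exact Function.Surjective.of_comp (LinearMap.injective_iff_surjective.1 hD)
  obtain ⟨d, hdA, hd0, hd⟩ := exists_direction_of_surjective hsurj (hνA z₀ hz₀) (hν1 z₀ hz₀)
  have ht : ∀ z ∈ Z, ∃ t : ℝ, ν z = ν z₀ + t • d := fun z hz => hd _ (hνA z hz) (hν1 z hz)
  choose! t ht using ht
  let e : Fin (n + 2) → ℝ := fun i => d i / ν z₀ i
  have he : ∀ z ∈ Z, ∀ i, 1 + e i * t z = ν z i / ν z₀ i := fun z hz i => by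
    have := (hνpos z₀ hz₀ i).ne'
    rw [ht z hz]
    simp only [e, Pi.add_apply, Pi.smul_apply, smul_eq_mul]
    field_simp
  refine ⟨e, Z.image t, card_image_of_injOn fun z hz z' hz' h => hνinj z hz z' hz' ?_, ?_, ?_⟩
  · rw [ht z hz, ht z' hz', h]
  · intro τ hτ
    obtain ⟨z, hz, rfl⟩ := mem_image.1 hτ
    refine ⟨fun i => ?_, ?_⟩
    · rw [he z hz]
      exact div_pos (hνpos z hz i) (hνpos z₀ hz₀ i)
    · rw [← sum_mul_affine hl.1.2.1 hl.1.2.2 (-Real.log (s z) + Real.log (s z₀))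
        ((fun j => Real.log (z j)) - fun j => Real.log (z₀ j))]
      refine sum_congr rfl fun i _ => ?_
      rw [he z hz, Real.log_div (hνpos z hz i).ne' (hνpos z₀ hz₀ i).ne', hνlog z hz,
        hνlog z₀ hz₀, dotProduct_sub]
      ring
  · -- If the sum vanished, `e` would be affine in the exponents, which gives a tangent vector of
    -- the line of solutions of the linear system that the Jacobian annihilates.
    intro h0
    obtain ⟨a, y, hy⟩ := hl.exists_affine h0
    have hdi : ∀ i, d i = ν z₀ i * (a + w' i ⬝ᵥ y) := fun i => by
      rw [← hy i, mul_div_cancel₀ _ (hνpos z₀ hz₀ i).ne']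
    have hy0 : y = 0 := (hZ z₀ hz₀).2.2 y (by
      have : (fun i => monom (w' i) z₀ * (w' i ⬝ᵥ y)) = s z₀ • d - (a * s z₀) • ν z₀ := by
        funext i
        have h1 : monom (w' i) z₀ = s z₀ * ν z₀ i := by
          change _ = s z₀ * ((s z₀)⁻¹ * monom (w' i) z₀)
          rw [mul_inv_cancel_left₀ (hs z₀ hz₀).ne']
        simp only [Pi.sub_apply, Pi.smul_apply, smul_eq_mul, h1, hdi]
        ring
      rw [this, mulVec_sub, mulVec_smul, mulVec_smul, hdA, hνA z₀ hz₀, smul_zero, smul_zero,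
        sub_zero])
    have hda : ∀ i, d i = a * ν z₀ i := fun i => by
      rw [hdi, hy0, dotProduct_zero]
      ring
    have ha : a = 0 := by
      have := hd0
      simp only [hda, ← mul_sum, hν1 z₀ hz₀, mul_one] at this
      exact this
    have hd00 : d = 0 := funext fun i => by rw [hda, ha, zero_mul, Pi.zero_apply]
    exact hne (hνinj _ hz₀ _ hz₁ (by rw [ht z₁ hz₁, hd00, smul_zero, add_zero]))

/-- The sequence that continues `l` by zeros. -/
noncomputable def natExt {N : ℕ} (l : Fin N → ℝ) : ℕ → ℝ := Function.extend Fin.val l 0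

@[simp]
theorem natExt_coe {N : ℕ} (l : Fin N → ℝ) (i : Fin N) : natExt l i = l i :=
  Fin.val_injective.extend_apply _ _ _

theorem natExt_of_lt {N : ℕ} (l : Fin N → ℝ) {k : ℕ} (hk : k < N) : natExt l k = l ⟨k, hk⟩ :=
  natExt_coe l ⟨k, hk⟩

theorem mem_posInterval_natExt {N : ℕ} {e : Fin N → ℝ} {t : ℝ} :
    t ∈ posInterval (natExt e) N ↔ ∀ i, 0 < 1 + e i * t :=
  ⟨fun h i => by simpa using h i i.2, fun h k hk => by rw [natExt_of_lt e hk]; exact h _⟩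

theorem logSum_natExt {N : ℕ} (l e : Fin N → ℝ) (t : ℝ) :
    logSum (natExt l) (natExt e) N t = ∑ i, l i * Real.log (1 + e i * t) := by
  simp [logSum, sum_range]

theorem logSumDeriv_natExt_zero {N : ℕ} (l e : Fin N → ℝ) :
    logSumDeriv (natExt l) (natExt e) N 0 = ∑ i, l i * e i := by
  simp [logSumDeriv, sum_range]

/-- With `n + 2` solutions the logarithm would have a critical point too many for the degree of the
numerator of its derivative, hence would be constant. -/
theorem card_nondegPosSolutions_le {n : ℕ} {f : Fin n → GenPoly n} {W : Set (Fin n → ℝ)}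
    (hf : systemSupport f ⊆ W) (w : Fin (n + 2) ≃ W) {l : Fin (n + 2) → ℝ}
    (hl : IsUniqueRelation (fun i => (w i : Fin n → ℝ)) l) {Z : Finset (Fin n → ℝ)}
    (hZ : ∀ z ∈ Z, z ∈ nondegPosSolutions f) : #Z ≤ n + 1 := by
  by_contra! hcard
  obtain ⟨e, Y, hY, hYt, h0⟩ := exists_gale_dual hf w hl hZ (by omega)
  refine h0 ?_
  rw [← logSumDeriv_natExt_zero]
  refine logSumDeriv_eq_zero_of_card_roots (K := 0) (by simpa [sum_range] using hl.1.2.1) (Y := Y)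
    (by omega) (fun y hy => ?_) (mem_posInterval_natExt.2 (by simp))
  rw [mem_posInterval_natExt, logSum_natExt]
  exact hYt y hy

/-- The permutation sorts the parameters `eᵢ` of the Gale dual. -/
theorem exists_perm_alternating_partialSum {n : ℕ} (hn : 1 ≤ n) {f : Fin n → GenPoly n}
    {W : Set (Fin n → ℝ)} (hf : systemSupport f ⊆ W) (w : Fin (n + 2) ≃ W) {l : Fin (n + 2) → ℝ}
    (hl : IsUniqueRelation (fun i => (w i : Fin n → ℝ)) l) {Z : Finset (Fin n → ℝ)}
    (hZ : ∀ z ∈ Z, z ∈ nondegPosSolutions f) (hcard : #Z = n + 1) :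
    ∃ σ : Equiv.Perm (Fin (n + 2)), ∀ k < n,
      (∑ i ∈ range (k + 1), natExt (l ∘ σ) i) * (∑ i ∈ range (k + 2), natExt (l ∘ σ) i) < 0 := by
  obtain ⟨e, Y, hY, hYt, h0⟩ := exists_gale_dual hf w hl hZ (by omega)
  refine ⟨Tuple.sort e, ?_⟩
  refine partialSum_alternate_of_card_roots (K := 0) hn (e := natExt (e ∘ Tuple.sort e)) ?_ ?_
    (Y := Y) (by omega) (fun y hy => ?_) (t := 0) (mem_posInterval_natExt.2 (by simp)) ?_
  · rw [sum_range, ← hl.1.2.1, ← Equiv.sum_comp (Tuple.sort e) l]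
    simp
  · intro i j hij hj
    rw [natExt_of_lt _ hj, natExt_of_lt _ (hij.trans_lt hj)]
    exact Tuple.monotone_sort e hij
  · rw [mem_posInterval_natExt, logSum_natExt]
    refine ⟨fun i => (hYt y hy).1 _, ?_⟩
    rw [← (hYt y hy).2]
    exact Equiv.sum_comp (Tuple.sort e) fun i => l i * Real.log (1 + e i * y)
  · rw [logSumDeriv_natExt_zero]
    rw [← Equiv.sum_comp (Tuple.sort e)] at h0
    exact h0

end

/-! ### Logarithmic equations with the maximal number of roots -/

theorem abs_log_one_add_exp_sub_max_le (x : ℝ) :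
    |Real.log (1 + Real.exp x) - max 0 x| ≤ Real.log 2 := by
  have h1 : Real.exp (max 0 x) ≤ 1 + Real.exp x := by
    rcases le_total 0 x with h | h
    · rw [max_eq_right h]
      linarith
    · rw [max_eq_left h, Real.exp_zero]
      linarith [Real.exp_pos x]
  have h2 : 1 + Real.exp x ≤ 2 * Real.exp (max 0 x) := by
    have h3 : 1 ≤ Real.exp (max 0 x) := Real.one_le_exp (le_max_left _ _)
    have h4 : Real.exp x ≤ Real.exp (max 0 x) := Real.exp_le_exp.2 (le_max_right _ _)
    linarith
  have h5 := Real.log_le_log (Real.exp_pos _) h1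
  have h6 := Real.log_le_log (by positivity) h2
  rw [Real.log_exp] at h5
  rw [Real.log_mul (by norm_num) (Real.exp_pos _).ne', Real.log_exp] at h6
  rw [abs_le]
  have := Real.log_nonneg (show (1 : ℝ) ≤ 2 by norm_num)
  constructor <;> linarith

/-- A piecewise linear function with slope `μₖ`, the `k`-th partial sum of `l`, between the
breakpoints `s k` and `s (k + 1)`, evaluated at a breakpoint. -/
theorem sum_mul_max_eq {l s : ℕ → ℝ} {N k : ℕ} (hs : ∀ i j, i < j → j < N → s i < s j)
    (hk : k < N) :
    ∑ i ∈ range N, l i * max 0 (s k - s i) =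
      ∑ j ∈ range k, (∑ i ∈ range (j + 1), l i) * (s (j + 1) - s j) := by
  have h1 : ∑ i ∈ range N, l i * max 0 (s k - s i) =
      ∑ i ∈ range (k + 1), l i * (s k - s i) := by
    rw [← sum_subset (range_subset_range.2 (show k + 1 ≤ N by omega))]
    · refine sum_congr rfl fun i hi => ?_
      have hi := mem_range.1 hi
      rcases Nat.lt_or_ge i k with h | h
      · rw [max_eq_right (sub_pos.2 (hs i k h hk)).le]
      · rw [show i = k by omega]
        simp
    · intro i hi hi'
      rw [mem_range] at hi hi'
      rw [max_eq_left (sub_neg.2 (hs k i (by omega) hi)).le, mul_zero]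
  rw [h1, sum_mul_eq_sum_partialSum_mul]
  simp

/-- The logarithm of a product with roots `-exp (L * s k)` on widely different scales approximates
a piecewise linear function in the variable `log t / L`. If its slopes `μₖ` alternate in sign, then
with the distances `1 / |μₖ|` of the breakpoints it runs back and forth between the values `0` and
`1`, and crosses the level `1 / 2` on each of the `n + 1` segments. -/
theorem exists_alternating_values {l : ℕ → ℝ} {n : ℕ}
    (halt : ∀ k ≤ n, 0 < (-1) ^ k * ∑ i ∈ range (k + 1), l i) :
    ∃ (e t : ℕ → ℝ) (K : ℝ), (∀ i j, i < j → j < n + 2 → e j < e i) ∧ (∀ i, 0 < e i) ∧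
      (∀ k, 0 < t k) ∧ (∀ i j, i < j → j < n + 2 → t i < t j) ∧
      ∀ k < n + 2, (-1) ^ k * (logSum l e (n + 2) (t k) - K) < 0 := by
  let M : ℕ → ℝ := fun k => (-1) ^ k * ∑ i ∈ range (k + 1), l i
  let s : ℕ → ℝ := fun k => ∑ j ∈ range k, (M j)⁻¹
  have hs1 : ∀ k, s (k + 1) - s k = (M k)⁻¹ := fun k => by simp [s, sum_range_succ]
  have hs : ∀ i j, i < j → j < n + 2 → s i < s j := by
    intro i j hij hj
    refine sum_lt_sum_of_subset (i := i) (range_subset_range.2 hij.le) (by simpa using hij)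
      (by simp) (inv_pos.2 (halt i (by omega))) fun k hk _ => ?_
    exact (inv_pos.2 (halt k (by have := mem_range.1 hk; omega))).le
  have hG : ∀ k < n + 2, ∑ i ∈ range (n + 2), l i * max 0 (s k - s i) =
      ∑ j ∈ range k, (-1 : ℝ) ^ j := by
    intro k hk
    rw [sum_mul_max_eq hs hk]
    refine sum_congr rfl fun j hj => ?_
    have hj := mem_range.1 hj
    have hM : M j ≠ 0 := (halt j (by omega)).ne'
    have h1 : ∑ i ∈ range (j + 1), l i = (-1) ^ j * M j := by
      simp only [M]
      rw [← mul_assoc, ← mul_pow]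
      simp
    rw [hs1, h1, mul_assoc, mul_inv_cancel₀ hM, mul_one]
  have hgeom : ∀ k, ∑ j ∈ range k, (-1 : ℝ) ^ j = (1 - (-1) ^ k) / 2 := fun k => by
    rw [geom_sum_eq (by norm_num)]
    ring
  set B : ℝ := ∑ i ∈ range (n + 2), |l i| * Real.log 2 with hB
  have hlog2 : 0 ≤ Real.log 2 := Real.log_nonneg (by norm_num)
  have hB0 : 0 ≤ B := sum_nonneg fun i _ => mul_nonneg (abs_nonneg _) hlog2
  set L : ℝ := 2 * B + 1 with hL
  have hL0 : 0 < L := by linarith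
  have happrox : ∀ k < n + 2,
      |logSum l (fun i => Real.exp (-(L * s i))) (n + 2) (Real.exp (L * s k)) -
        L * ∑ j ∈ range k, (-1 : ℝ) ^ j| ≤ B := by
    intro k hk
    clear_value s
    rw [← hG k hk, logSum, mul_sum, ← sum_sub_distrib]
    refine (abs_sum_le_sum_abs _ _).trans (sum_le_sum fun i _ => ?_)
    have h1 : L * (l i * max 0 (s k - s i)) = l i * max 0 (L * (s k - s i)) := by
      rw [mul_left_comm, ← mul_zero L, mul_max_of_nonneg _ _ hL0.le]
      simp
    rw [h1, ← mul_sub, abs_mul, ← Real.exp_add,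
      show -(L * s i) + L * s k = L * (s k - s i) by ring]
    exact mul_le_mul_of_nonneg_left (abs_log_one_add_exp_sub_max_le _) (abs_nonneg _)
  refine ⟨fun i => Real.exp (-(L * s i)), fun k => Real.exp (L * s k), L / 2, ?_,
    fun i => Real.exp_pos _, fun k => Real.exp_pos _, ?_, ?_⟩
  · intro i j hij hj
    exact Real.exp_lt_exp.2 (neg_lt_neg (mul_lt_mul_of_pos_left (hs i j hij hj) hL0))
  · intro i j hij hj
    exact Real.exp_lt_exp.2 (mul_lt_mul_of_pos_left (hs i j hij hj) hL0)
  · intro k hk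
    have h1 := happrox k hk
    rw [hgeom, abs_le] at h1
    rcases neg_one_pow_eq_or ℝ k with h | h
    · rw [h] at h1 ⊢
      linarith [h1.2]
    · rw [h] at h1 ⊢
      linarith [h1.1]

theorem exists_simple_roots {l : ℕ → ℝ} {n : ℕ} (hl : ∑ i ∈ range (n + 2), l i = 0)
    (halt : ∀ k ≤ n, 0 < (-1) ^ k * ∑ i ∈ range (k + 1), l i) :
    ∃ (e : ℕ → ℝ) (K : ℝ) (Y : Finset ℝ), (∀ i j, i < j → j < n + 2 → e j < e i) ∧
      #Y = n + 1 ∧ ∀ y ∈ Y, y ∈ posInterval e (n + 2) ∧ logSum l e (n + 2) y = K ∧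
        logSumDeriv l e (n + 2) y ≠ 0 := by
  obtain ⟨e, t, K, he, he0, ht0, ht, hval⟩ := exists_alternating_values halt
  have hpos : ∀ x : ℝ, 0 < x → x ∈ posInterval e (n + 2) := fun x hx j _ =>
    add_pos one_pos (mul_pos (he0 j) hx)
  have hroot : ∀ k < n + 1, ∃ y, t k < y ∧ y < t (k + 1) ∧ logSum l e (n + 2) y = K := by
    intro k hk
    have hlt := ht k (k + 1) (Nat.lt_succ_self k) (by omega)
    have hc : ContinuousOn (logSum l e (n + 2)) (Set.Icc (t k) (t (k + 1))) := fun x hx =>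
      (hasDerivAt_logSum l e (hpos x ((ht0 k).trans_le hx.1))).continuousAt.continuousWithinAt
    have h1 := hval k (by omega)
    have h2 := hval (k + 1) (by omega)
    rw [pow_succ] at h2
    rcases neg_one_pow_eq_or ℝ k with h | h
    · rw [h] at h1 h2
      obtain ⟨y, hy, hyK⟩ := intermediate_value_Ioo hlt.le hc
        (show K ∈ Set.Ioo _ _ from ⟨by linarith, by linarith⟩)
      exact ⟨y, hy.1, hy.2, hyK⟩
    · rw [h] at h1 h2
      obtain ⟨y, hy, hyK⟩ := intermediate_value_Ioo' hlt.le hc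
        (show K ∈ Set.Ioo _ _ from ⟨by linarith, by linarith⟩)
      exact ⟨y, hy.1, hy.2, hyK⟩
  choose! y hy1 hy2 hyK using hroot
  have hylt : ∀ i j, i < j → j < n + 1 → y i < y j := by
    intro i j hij hj
    refine (hy2 i (by omega)).trans_le (le_trans ?_ (hy1 j hj).le)
    rcases Nat.lt_or_ge (i + 1) j with h | h
    · exact (ht _ _ h (by omega)).le
    · rw [show i + 1 = j by omega]
  have hcard : #((range (n + 1)).image y) = n + 1 := by
    rw [card_image_of_injOn, card_range]
    intro i hi j hj hij
    rw [SetLike.mem_coe, mem_range] at hi hj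
    rcases lt_trichotomy i j with h | h | h
    · exact absurd hij (hylt i j h hj).ne
    · exact h
    · exact absurd hij (hylt j i h hi).ne'
  have hY : ∀ x ∈ (range (n + 1)).image y,
      x ∈ posInterval e (n + 2) ∧ logSum l e (n + 2) x = K := by
    intro x hx
    obtain ⟨k, hk, rfl⟩ := mem_image.1 hx
    have hk := mem_range.1 hk
    exact ⟨hpos _ ((ht0 k).trans (hy1 k hk)), hyK k hk⟩
  refine ⟨e, K, (range (n + 1)).image y, he, hcard, fun x hx =>
    ⟨(hY x hx).1, (hY x hx).2, fun hx0 => ?_⟩⟩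
  have h01 := ht 0 1 one_pos (by omega)
  obtain ⟨c, hc, hcs⟩ := exists_hasDerivAt_eq_slope (logSum l e (n + 2))
    (logSumDeriv l e (n + 2)) h01
    (fun x hx => (hasDerivAt_logSum l e (hpos x ((ht0 0).trans_le hx.1))).continuousAt.continuousWithinAt)
    (fun x hx => hasDerivAt_logSum l e (hpos x ((ht0 0).trans hx.1)))
  rw [logSumDeriv_eq_zero_of_double_root hl hcard.ge hY hx hx0 (hpos c ((ht0 0).trans hc.1))] at hcs
  have h0 := hval 0 (by omega)
  have h1 := hval 1 (by omega)
  rcases div_eq_zero_iff.1 hcs.symm with h | h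
  · simp at h0 h1
    linarith
  · linarith

/-! ### Construction of a system from its Gale dual -/

section

open Matrix

/-- Every plane in `ℝⁿ⁺²` is the kernel of an `n × (n + 2)` matrix. -/
theorem exists_matrix_ker {n : ℕ} {T : ℝ × ℝ →ₗ[ℝ] (Fin (n + 2) → ℝ)}
    (hT : Function.Injective T) :
    ∃ A : Matrix (Fin n) (Fin (n + 2)) ℝ, ∀ x, A *ᵥ x = 0 ↔ ∃ p, T p = x := by
  have h1 := LinearMap.finrank_range_of_inj hT
  have h2 := (LinearMap.range T).finrank_quotient_add_finrank
  simp only [h1, Module.finrank_prod, Module.finrank_self, Module.finrank_fin_fun] at h2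
  let E : ((Fin (n + 2) → ℝ) ⧸ LinearMap.range T) ≃ₗ[ℝ] (Fin n → ℝ) :=
    LinearEquiv.ofFinrankEq _ _ (by simp only [Module.finrank_fin_fun]; omega)
  refine ⟨LinearMap.toMatrix' (E.toLinearMap ∘ₗ (LinearMap.range T).mkQ), fun x => ?_⟩
  rw [LinearMap.toMatrix'_mulVec]
  simp

/-- The system with given coefficient matrix. -/
noncomputable def systemOfMatrix {n N : ℕ} {W : Set (Fin n → ℝ)} (w : Fin N ≃ W)
    (A : Matrix (Fin n) (Fin N) ℝ) : Fin n → GenPoly n :=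
  fun j => (Finsupp.equivFunOnFinite.symm (A j)).embDomain
    (w.toEmbedding.trans (Function.Embedding.subtype _))

theorem systemOfMatrix_apply {n N : ℕ} {W : Set (Fin n → ℝ)} (w : Fin N ≃ W)
    (A : Matrix (Fin n) (Fin N) ℝ) (j : Fin n) (i : Fin N) :
    systemOfMatrix w A j (w i : Fin n → ℝ) = A j i :=
  Finsupp.embDomain_apply_self (w.toEmbedding.trans (Function.Embedding.subtype _)) _ i

theorem coeffMatrix_systemOfMatrix {n N : ℕ} {W : Set (Fin n → ℝ)} (w : Fin N ≃ W)
    (A : Matrix (Fin n) (Fin N) ℝ) :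
    coeffMatrix (systemOfMatrix w A) (fun i => (w i : Fin n → ℝ)) = A := by
  ext j i
  exact systemOfMatrix_apply w A j i

theorem systemSupport_systemOfMatrix {n N : ℕ} {W : Set (Fin n → ℝ)} (w : Fin N ≃ W)
    {A : Matrix (Fin n) (Fin N) ℝ} (hA : ∀ i, ∃ j, A j i ≠ 0) :
    systemSupport (systemOfMatrix w A) = W := by
  ext u
  simp only [systemSupport, Set.mem_iUnion, SetLike.mem_coe]
  constructor
  · rintro ⟨j, hj⟩
    rw [systemOfMatrix, Finsupp.support_embDomain, mem_map] at hj
    obtain ⟨i, -, rfl⟩ := hj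
    exact (w i).2
  · intro hu
    obtain ⟨j, hj⟩ := hA (w.symm ⟨u, hu⟩)
    refine ⟨j, Finsupp.mem_support_iff.2 ?_⟩
    rw [← systemOfMatrix_apply w A] at hj
    simpa using hj

/-- Gale duality in the converse direction: simple roots `t` of `∑ λᵢ log (1 + eᵢ t) = K` give
non-degenerate positive solutions of a system whose coefficient matrix has the kernel
`{(cᵢ (a + b eᵢ))ᵢ}`, where the positive constants `cᵢ` absorb `K`. -/
theorem exists_system_of_simple_roots {n : ℕ} {W : Set (Fin n → ℝ)} (hn : 1 ≤ n)
    (w : Fin (n + 2) ≃ W) {l : Fin (n + 2) → ℝ}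
    (hl : IsUniqueRelation (fun i => (w i : Fin n → ℝ)) l) {e : Fin (n + 2) → ℝ}
    (he : Function.Injective e) {K : ℝ} {Y : Finset ℝ}
    (hY : ∀ y ∈ Y, (∀ i, 0 < 1 + e i * y) ∧ ∑ i, l i * Real.log (1 + e i * y) = K ∧
      ∑ i, l i * (e i / (1 + e i * y)) ≠ 0) :
    ∃ f : Fin n → GenPoly n, systemSupport f = W ∧
      ∃ Z : Finset (Fin n → ℝ), #Z = #Y ∧ ∀ z ∈ Z, z ∈ nondegPosSolutions f := by
  set w' : Fin (n + 2) → (Fin n → ℝ) := fun i => (w i : Fin n → ℝ) with hw'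
  obtain ⟨i₀, hi₀⟩ := Function.ne_iff.1 hl.1.1
  have hi₀ : l i₀ ≠ 0 := hi₀
  let b : Fin (n + 2) → ℝ := Pi.single i₀ (-K / l i₀)
  have hb : ∑ i, l i * b i = -K := by
    simp only [b, Pi.single_apply, mul_ite, mul_zero, sum_ite_eq', mem_univ, if_true]
    field_simp
  let c : Fin (n + 2) → ℝ := fun i => Real.exp (b i)
  have hc : ∀ i, 0 < c i := fun i => Real.exp_pos _
  let T : ℝ × ℝ →ₗ[ℝ] (Fin (n + 2) → ℝ) :=
    { toFun := fun p i => c i * (p.1 + e i * p.2)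
      map_add' := fun p q => by
        funext i
        simp only [Prod.fst_add, Prod.snd_add, Pi.add_apply]
        ring
      map_smul' := fun r p => by
        funext i
        simp only [Prod.smul_fst, Prod.smul_snd, Pi.smul_apply, smul_eq_mul, RingHom.id_apply]
        ring }
  -- A linear function of `eᵢ` that vanishes for two indices is zero.
  have htwo : ∀ (r q : ℝ) (i j : Fin (n + 2)), i ≠ j → r + e i * q = 0 → r + e j * q = 0 →
      r = 0 ∧ q = 0 := by
    intro r q i j hij hi hj
    have h1 : (e i - e j) * q = 0 := by linarith
    have hq := (mul_eq_zero.1 h1).resolve_left (sub_ne_zero.2 (he.ne hij))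
    rw [hq] at hi
    exact ⟨by linarith, hq⟩
  have h01 : (0 : Fin (n + 2)) ≠ 1 := by simp
  have hT : Function.Injective T := (injective_iff_map_eq_zero T).2 fun p hp => by
    have h : ∀ i, p.1 + e i * p.2 = 0 := fun i =>
      (mul_eq_zero.1 (congrFun hp i)).resolve_left (hc i).ne'
    obtain ⟨h1, h2⟩ := htwo _ _ _ _ h01 (h 0) (h 1)
    exact Prod.ext h1 h2
  obtain ⟨A, hA⟩ := exists_matrix_ker hT
  have hcol : ∀ i, ∃ j, A j i ≠ 0 := by
    intro i
    by_contra! hcon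
    obtain ⟨p, hp⟩ := (hA (Pi.single i 1)).1 (by
      rw [mulVec_single_one]
      exact funext hcon)
    have h : ∀ k, k ≠ i → p.1 + e k * p.2 = 0 := fun k hk => by
      have h1 := congrFun hp k
      rw [Pi.single_eq_of_ne hk] at h1
      exact (mul_eq_zero.1 h1).resolve_left (hc k).ne'
    obtain ⟨j, k, hj, hk, hjk⟩ : ∃ j k : Fin (n + 2), j ≠ i ∧ k ≠ i ∧ j ≠ k := by
      have hcard : 1 < #(univ.erase i) := by
        rw [card_erase_of_mem (mem_univ i), card_univ, Fintype.card_fin]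
        omega
      obtain ⟨j, hj, k, hk, hjk⟩ := one_lt_card.1 hcard
      exact ⟨j, k, ne_of_mem_erase hj, ne_of_mem_erase hk, hjk⟩
    obtain ⟨h1, h2⟩ := htwo _ _ j k hjk (h j hj) (h k hk)
    have h3 := congrFun hp i
    rw [Pi.single_eq_same] at h3
    have h4 : T p i = c i * (p.1 + e i * p.2) := rfl
    rw [h4, h1, h2] at h3
    simp at h3
  have hsupp := systemSupport_systemOfMatrix w hcol
  refine ⟨systemOfMatrix w A, hsupp, ?_⟩
  have hsol : ∀ y ∈ Y, ∃ (z : Fin n → ℝ) (r : ℝ), (∀ j, 0 < z j) ∧ 0 < r ∧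
      ∀ i, monom (w' i) z = r * (c i * (1 + e i * y)) := by
    intro y hy
    obtain ⟨a, v, hav⟩ := hl.exists_affine (y := fun i => b i + Real.log (1 + e i * y)) (by
      simp only [mul_add, sum_add_distrib, hb, (hY y hy).2.1]
      ring)
    refine ⟨fun j => Real.exp (v j), Real.exp (-a), fun j => Real.exp_pos _, Real.exp_pos _,
      fun i => ?_⟩
    rw [monom_eq_exp _ fun j => Real.exp_pos _]
    simp only [Real.log_exp, c]
    conv_rhs => rw [← Real.exp_log ((hY y hy).1 i)]
    rw [← Real.exp_add, ← Real.exp_add, hav i]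
    congr 1
    simp [w']
  choose! z r hz hr hzr using hsol
  refine ⟨Y.image z, card_image_of_injOn fun y hy y' hy' h => ?_, fun x hx => ?_⟩
  · have h1 : ∀ i, (r y - r y') + e i * (r y * y - r y' * y') = 0 := fun i => by
      have h2 := hzr y hy i
      rw [h, hzr y' hy' i, mul_left_comm, mul_left_comm (r y)] at h2
      have h3 := mul_left_cancel₀ (hc i).ne' h2
      linarith
    obtain ⟨h2, h3⟩ := htwo _ _ _ _ h01 (h1 0) (h1 1)
    rw [← sub_eq_zero.1 h2, ← mul_sub] at h3
    exact sub_eq_zero.1 ((mul_eq_zero.1 h3).resolve_left (hr y hy).ne')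
  · obtain ⟨y, hy, rfl⟩ := mem_image.1 hx
    rw [mem_nondegPosSolutions_iff hsupp.le w, coeffMatrix_systemOfMatrix]
    refine ⟨hz y hy, (hA _).2 ⟨(r y, r y * y), ?_⟩, fun v hv => ?_⟩
    · funext i
      change c i * (r y + e i * (r y * y)) = monom (w' i) (z y)
      rw [hzr y hy]
      ring
    · obtain ⟨p, hp⟩ := (hA _).1 hv
      have h1 : ∀ i, w' i ⬝ᵥ v =
          (r y)⁻¹ * (p.1 + (p.2 - p.1 * y) * (e i / (1 + e i * y))) := fun i => by
        have h2 : c i * (p.1 + e i * p.2) = monom (w' i) (z y) * (w' i ⬝ᵥ v) := congrFun hp i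
        rw [hzr y hy] at h2
        have h3 := (hc i).ne'
        have h4 := (hr y hy).ne'
        have h5 := ((hY y hy).1 i).ne'
        have h6 : p.1 + e i * p.2 = r y * (1 + e i * y) * (w' i ⬝ᵥ v) :=
          mul_left_cancel₀ h3 (by rw [h2]; ring)
        have h7 : p.1 + (p.2 - p.1 * y) * (e i / (1 + e i * y)) =
            (p.1 + e i * p.2) / (1 + e i * y) := by
          rw [eq_div_iff h5, add_mul, mul_assoc, div_mul_cancel₀ _ h5]
          ring
        rw [h7, h6]
        field_simp
      have h2 := sum_mul_affine hl.1.2.1 hl.1.2.2 0 v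
      have h3 : ∑ i, l i * (0 + w' i ⬝ᵥ v) =
          (r y)⁻¹ * (p.1 * ∑ i, l i +
            (p.2 - p.1 * y) * ∑ i, l i * (e i / (1 + e i * y))) := by
        simp only [h1, mul_sum, ← sum_add_distrib]
        exact sum_congr rfl fun i _ => by ring
      rw [h3, hl.1.2.1, mul_zero, zero_add] at h2
      have h4 : p.2 - p.1 * y = 0 :=
        (mul_eq_zero.1 ((mul_eq_zero.1 h2).resolve_left
          (inv_pos.2 (hr y hy)).ne')).resolve_right (hY y hy).2.2
      refine hl.eq_zero_of_affine_eq_zero (a := -((r y)⁻¹ * p.1)) fun i => ?_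
      rw [h1, h4]
      ring

/-- The lower bound comes from the simple roots of a Gale dual equation, and the general upper bound
makes the count exact. -/
theorem exists_system_of_alternating {n : ℕ} {W : Set (Fin n → ℝ)} (hn : 1 ≤ n)
    (w : Fin (n + 2) ≃ W) {l : Fin (n + 2) → ℝ}
    (hl : IsUniqueRelation (fun i => (w i : Fin n → ℝ)) l)
    (halt : ∀ k ≤ n, 0 < (-1) ^ k * ∑ i ∈ range (k + 1), natExt l i) :
    ∃ f : Fin n → GenPoly n, systemSupport f = W ∧ (nondegPosSolutions f).encard = n + 1 := by
  obtain ⟨e, K, Y, he, hcard, hY⟩ :=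
    exists_simple_roots (by simpa [sum_range] using hl.1.2.1) halt
  have heinj : Function.Injective fun i : Fin (n + 2) => e i := fun i j hij => by
    rcases lt_trichotomy i j with h | h | h
    · exact absurd hij (he i j h j.2).ne'
    · exact h
    · exact absurd hij (he j i h i.2).ne
  obtain ⟨f, hf, Z, hZ, hsol⟩ := exists_system_of_simple_roots hn w hl heinj (K := K) (Y := Y)
    fun y hy => ⟨fun i => (hY y hy).1 i i.2, by
      simpa [logSum, sum_range] using (hY y hy).2.1, by
      simpa [logSumDeriv, sum_range] using (hY y hy).2.2⟩
  refine ⟨f, hf, le_antisymm ?_ ?_⟩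
  · by_contra! hlt
    obtain ⟨S, hS, hScard⟩ := Set.exists_subset_encard_eq (Order.add_one_le_of_lt hlt)
    have hfin : S.Finite := Set.finite_of_encard_eq_coe (k := n + 2) (by rw [hScard]; norm_cast)
    have h1 := card_nondegPosSolutions_le hf.le w hl (Z := hfin.toFinset) fun z hz =>
      hS (hfin.mem_toFinset.1 hz)
    rw [hfin.encard_eq_coe_toFinset_card] at hScard
    have h2 : #hfin.toFinset = n + 1 + 1 := by exact_mod_cast hScard
    omega
  · have h1 : ((Z : Set (Fin n → ℝ))).encard ≤ (nondegPosSolutions f).encard :=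
      Set.encard_le_encard fun z hz => hsol z hz
    rw [Set.encard_coe_eq_coe_finsetCard, hZ, hcard] at h1
    exact_mod_cast h1

end

/-! ### Interleaved partial sums -/

/-- The order of the points in which the two sides of the relation interleave: the `α`-terms take
the even and the `β`-terms the odd places. -/
def interleave (n : ℕ) : Equiv.Perm (Fin (n + 2)) where
  toFun i := ⟨if (i : ℕ) < (n + 3) / 2 then 2 * i else 2 * (i - (n + 3) / 2) + 1, by
    split_ifs <;> omega⟩
  invFun j := ⟨if (j : ℕ) % 2 = 0 then j / 2 else (n + 3) / 2 + j / 2, by split_ifs <;> omega⟩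
  left_inv i := by
    ext
    dsimp only
    split_ifs <;> omega
  right_inv j := by
    ext
    dsimp only
    split_ifs <;> omega

theorem sum_range_two_mul (ν : ℕ → ℝ) (r : ℕ) :
    ∑ i ∈ range (2 * r), ν i = ∑ i ∈ range r, ν (2 * i) + ∑ i ∈ range r, ν (2 * i + 1) := by
  induction r with
  | zero => simp
  | succ r ih =>
    rw [show 2 * (r + 1) = 2 * r + 1 + 1 by ring, sum_range_succ, sum_range_succ, ih,
      sum_range_succ, sum_range_succ]
    ring

theorem sum_Icc_add_one (φ : ℕ → ℝ) (m r : ℕ) :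
    ∑ i ∈ Icc (m + 1) (m + r), φ i = ∑ i ∈ range r, φ (m + i + 1) := by
  rw [← Ico_succ_right_eq_Icc, sum_Ico_eq_sum_range]
  simp only [Order.succ_eq_add_one, show m + r + 1 - (m + 1) = r by omega]
  exact sum_congr rfl fun i _ => by congr 1; ring

/-- The inequalities between the sums of the `α` and the `β` say that the partial sums of the
interleaved sequence `ν` alternate in sign. -/
theorem inequalities_of_alternating {ν : ℕ → ℝ} {n : ℕ} (hν : ∑ i ∈ range (n + 2), ν i = 0)
    (halt : ∀ k ≤ n, 0 < (-1) ^ k * ∑ i ∈ range (k + 1), ν i) {m : ℕ} (hm : m = (n + 3) / 2)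
    {α β : ℕ → ℝ} (hα : ∀ i, α (i + 1) = ν (2 * i)) (hβ : ∀ i, β (m + i + 1) = -ν (2 * i + 1)) :
    (∀ i ∈ Icc 1 m, 0 < α i) ∧ (∀ i ∈ Icc (m + 1) (n + 2), 0 < β i) ∧
      ∀ r ∈ Icc 1 (n / 2),
        ∑ i ∈ Icc 1 r, α i < ∑ i ∈ Icc (m + 1) (m + r), β i ∧
        ∑ i ∈ Icc (m + 1) (m + r), β i < ∑ i ∈ Icc 1 (r + 1), α i := by
  have hsumα : ∀ r, ∑ i ∈ Icc 1 r, α i = ∑ i ∈ range r, ν (2 * i) := fun r => by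
    have := sum_Icc_add_one α 0 r
    simp only [zero_add] at this
    rw [this]
    exact sum_congr rfl fun i _ => hα i
  have hsumβ : ∀ r, ∑ i ∈ Icc (m + 1) (m + r), β i = -∑ i ∈ range r, ν (2 * i + 1) := fun r => by
    rw [sum_Icc_add_one, ← sum_neg_distrib]
    exact sum_congr rfl fun i _ => hβ i
  have hsign : ∀ k < n + 2, 0 < (-1) ^ k * ν k := by
    intro k hk
    rcases k with _ | k
    · simpa using halt 0 (Nat.zero_le _)
    · have h1 := halt k (by omega)
      have h2 : 0 ≤ (-1) ^ (k + 1) * ∑ i ∈ range (k + 2), ν i := by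
        rcases Nat.lt_or_ge n (k + 1) with h | h
        · rw [show k + 2 = n + 2 by omega, hν, mul_zero]
        · exact (halt (k + 1) h).le
      rw [sum_range_succ, pow_succ] at h2
      rw [pow_succ]
      linarith
  have heven : ∀ i, ((-1 : ℝ) ^ (2 * i)) = 1 := fun i => by simp [pow_mul]
  refine ⟨fun i hi => ?_, fun i hi => ?_, fun r hr => ⟨?_, ?_⟩⟩
  · rw [mem_Icc] at hi
    obtain ⟨j, rfl⟩ := Nat.exists_eq_add_of_le' hi.1
    have := hsign (2 * j) (by omega)
    rwa [heven, one_mul, ← hα] at this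
  · rw [mem_Icc] at hi
    obtain ⟨j, rfl⟩ := Nat.exists_eq_add_of_le hi.1
    have := hsign (2 * j + 1) (by omega)
    rw [pow_succ, heven] at this
    rw [show m + 1 + j = m + j + 1 by ring, hβ]
    linarith
  · rw [mem_Icc] at hr
    obtain ⟨j, rfl⟩ := Nat.exists_eq_add_of_le' hr.1
    have := halt (2 * j + 1) (by omega)
    rw [show 2 * j + 1 + 1 = 2 * (j + 1) by ring, sum_range_two_mul, pow_succ, heven] at this
    rw [hsumα, hsumβ]
    linarith
  · rw [mem_Icc] at hr
    have := halt (2 * r) (by omega)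
    rw [sum_range_succ, sum_range_two_mul, heven] at this
    rw [hsumα, hsumβ, sum_range_succ]
    linarith

theorem alternating_of_inequalities {ν : ℕ → ℝ} {n : ℕ} (hν : ∑ i ∈ range (n + 2), ν i = 0)
    {m : ℕ} (hm : m = (n + 3) / 2) {α β : ℕ → ℝ}
    (hα : ∀ i, 2 * i < n + 2 → α (i + 1) = ν (2 * i))
    (hβ : ∀ i, 2 * i + 1 < n + 2 → β (m + i + 1) = -ν (2 * i + 1))
    (hαpos : ∀ i ∈ Icc 1 m, 0 < α i)
    (h : ∀ r ∈ Icc 1 (n / 2),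
        ∑ i ∈ Icc 1 r, α i < ∑ i ∈ Icc (m + 1) (m + r), β i ∧
        ∑ i ∈ Icc (m + 1) (m + r), β i < ∑ i ∈ Icc 1 (r + 1), α i) :
    ∀ k ≤ n, 0 < (-1) ^ k * ∑ i ∈ range (k + 1), ν i := by
  have hsumα : ∀ r, 2 * r < n + 4 → ∑ i ∈ Icc 1 r, α i = ∑ i ∈ range r, ν (2 * i) := fun r hr => by
    have := sum_Icc_add_one α 0 r
    simp only [zero_add] at this
    rw [this]
    exact sum_congr rfl fun i hi => hα i (by have := mem_range.1 hi; omega)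
  have hsumβ : ∀ r, 2 * r < n + 3 →
      ∑ i ∈ Icc (m + 1) (m + r), β i = -∑ i ∈ range r, ν (2 * i + 1) := fun r hr => by
    rw [sum_Icc_add_one, ← sum_neg_distrib]
    exact sum_congr rfl fun i hi => hβ i (by have := mem_range.1 hi; omega)
  have heven : ∀ i, ((-1 : ℝ) ^ (2 * i)) = 1 := fun i => by simp [pow_mul]
  intro k hk
  rcases Nat.even_or_odd' k with ⟨r, rfl | rfl⟩
  · rw [heven, one_mul, sum_range_succ, sum_range_two_mul]
    rcases r with _ | r
    · have := hαpos 1 (mem_Icc.2 ⟨le_rfl, by omega⟩)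
      rw [hα 0 (by omega)] at this
      simpa using this
    · have := (h (r + 1) (mem_Icc.2 ⟨by omega, by omega⟩)).2
      rw [hsumα _ (by omega), hsumβ _ (by omega), sum_range_succ _ (r + 1)] at this
      linarith
  · rw [pow_succ, heven]
    rcases Nat.lt_or_ge (n / 2) (r + 1) with hr | hr
    · -- The last partial sum for odd `n` is the negative of the last term, an `α`.
      have hn : n = 2 * r + 1 := by omega
      have h1 := hαpos m (mem_Icc.2 ⟨by omega, le_rfl⟩)
      rw [show m = r + 1 + 1 by omega, hα (r + 1) (by omega)] at h1
      rw [hn, sum_range_succ, show 2 * r + 1 + 1 = 2 * (r + 1) by ring] at hν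
      rw [show 2 * r + 1 + 1 = 2 * (r + 1) by ring]
      linarith
    · have := (h (r + 1) (mem_Icc.2 ⟨by omega, hr⟩)).1
      rw [hsumα _ (by omega), hsumβ _ (by omega)] at this
      rw [show 2 * r + 1 + 1 = 2 * (r + 1) by ring, sum_range_two_mul]
      linarith

theorem exists_sign_alternating {μ : ℕ → ℝ} {n : ℕ} (hn : 1 ≤ n)
    (h : ∀ k < n, μ k * μ (k + 1) < 0) :
    (∀ k ≤ n, 0 < (-1) ^ k * μ k) ∨ ∀ k ≤ n, 0 < (-1) ^ k * -μ k := by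
  have key : ∀ μ : ℕ → ℝ, (∀ k < n, μ k * μ (k + 1) < 0) → 0 < μ 0 →
      ∀ k ≤ n, 0 < (-1) ^ k * μ k := by
    intro μ h h0 k
    induction k with
    | zero => intro _; simpa using h0
    | succ k ih =>
      intro hk
      have h1 := ih (by omega)
      have h2 := h k (by omega)
      rw [pow_succ]
      rcases neg_one_pow_eq_or ℝ k with h3 | h3
      · rw [h3] at h1 ⊢
        nlinarith
      · rw [h3] at h1 ⊢
        nlinarith
  have h0 : μ 0 ≠ 0 := fun h0 => by
    have := h 0 (by omega)
    rw [h0, zero_mul] at this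
    exact lt_irrefl _ this
  rcases lt_or_gt_of_ne h0 with hneg | hpos
  · exact Or.inr (key (fun k => -μ k) (fun k hk => by simpa using h k hk) (neg_pos.2 hneg))
  · exact Or.inl (key μ h hpos)

/-! ### Relations of a circuit and the two implications -/

theorem IsAffineRelation.comp_perm {n : ℕ} {w : Fin (n + 2) → (Fin n → ℝ)} {l : Fin (n + 2) → ℝ}
    (h : IsAffineRelation w l) (σ : Equiv.Perm (Fin (n + 2))) :
    IsAffineRelation (w ∘ σ) (l ∘ σ) := by
  refine ⟨fun h0 => h.1 (funext fun i => ?_), ?_, ?_⟩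
  · simpa using congrFun h0 (σ.symm i)
  · exact (Equiv.sum_comp σ l).trans h.2.1
  · exact (Equiv.sum_comp σ fun i => l i • w i).trans h.2.2

theorem IsAffineRelation.neg {n : ℕ} {w : Fin (n + 2) → (Fin n → ℝ)} {l : Fin (n + 2) → ℝ}
    (h : IsAffineRelation w l) : IsAffineRelation w (-l) := by
  refine ⟨neg_ne_zero.2 h.1, ?_, ?_⟩
  · simp [h.2.1]
  · simp [h.2.2]

theorem exists_isWrittenAs_of_alternating {n : ℕ} {l : Fin (n + 2) → ℝ} {ν : ℕ → ℝ}
    (hν : ∑ i ∈ range (n + 2), ν i = 0)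
    (halt : ∀ k ≤ n, 0 < (-1) ^ k * ∑ i ∈ range (k + 1), ν i)
    (hl : (∀ i, l i = ν (interleave n i)) ∨ ∀ i, -l i = ν (interleave n i)) :
    ∃ (m : ℕ) (α β : ℕ → ℝ), m = (n + 3) / 2 ∧ IsWrittenAs l m α β ∧
      (∀ i ∈ Icc 1 m, 0 < α i) ∧ (∀ i ∈ Icc (m + 1) (n + 2), 0 < β i) ∧
      ∀ r ∈ Icc 1 (n / 2),
        ∑ i ∈ Icc 1 r, α i < ∑ i ∈ Icc (m + 1) (m + r), β i ∧
        ∑ i ∈ Icc (m + 1) (m + r), β i < ∑ i ∈ Icc 1 (r + 1), α i := by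
  refine ⟨(n + 3) / 2, fun i => ν (2 * (i - 1)), fun i => -ν (2 * (i - (n + 3) / 2 - 1) + 1), rfl,
    ?_, inequalities_of_alternating hν halt rfl (fun i => by simp) fun i => ?_⟩
  · have key : ∀ i : Fin (n + 2), ν (interleave n i) =
        if (i : ℕ) + 1 ≤ (n + 3) / 2 then ν (2 * (i + 1 - 1))
        else - -ν (2 * (i + 1 - (n + 3) / 2 - 1) + 1) := by
      intro i
      simp only [interleave, Equiv.coe_fn_mk]
      split_ifs with h1 h2 h2
      · simp
      · omega
      · omega
      · rw [neg_neg]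
        congr 3
        omega
    exact hl.imp (fun h i => (h i).trans (key i)) fun h i => (h i).trans (key i)
  · rw [show (n + 3) / 2 + i + 1 - (n + 3) / 2 - 1 = i by omega]

/-- The points are numbered by the order of the parameters `eᵢ` of the Gale dual, interleaved. As all
affine relations are proportional, one sign pattern decides about all of them. -/
theorem exists_numbering_of_system {n : ℕ} (hn : 1 ≤ n) {W : Set (Fin n → ℝ)} (hW : IsCircuit W)
    {f : Fin n → GenPoly n} (hf : systemSupport f = W)
    (hcard : (nondegPosSolutions f).encard = n + 1) :
    ∃ w : Fin (n + 2) ≃ W, ∀ l : Fin (n + 2) → ℝ,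
      IsAffineRelation (fun i => (w i : Fin n → ℝ)) l →
      ∃ ν : ℕ → ℝ, ∑ i ∈ range (n + 2), ν i = 0 ∧
        (∀ k ≤ n, 0 < (-1) ^ k * ∑ i ∈ range (k + 1), ν i) ∧
        ((∀ i, l i = ν (interleave n i)) ∨ ∀ i, -l i = ν (interleave n i)) := by
  obtain ⟨w₀⟩ := hW.exists_equiv
  obtain ⟨l₀, hl₀⟩ := hW.exists_isAffineRelation w₀
  have hfin : (nondegPosSolutions f).Finite :=
    Set.finite_of_encard_eq_coe (k := n + 1) (by rw [hcard]; norm_cast)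
  rw [hfin.encard_eq_coe_toFinset_card] at hcard
  obtain ⟨σ, hσ⟩ := exists_perm_alternating_partialSum hn hf.le w₀ (hW.isUniqueRelation w₀ hl₀)
    (Z := hfin.toFinset) (fun z hz => hfin.mem_toFinset.1 hz) (by exact_mod_cast hcard)
  set ν := natExt (l₀ ∘ σ) with hν
  have hν0 : ∑ i ∈ range (n + 2), ν i = 0 := by
    rw [sum_range, ← hl₀.2.1, ← Equiv.sum_comp σ l₀]
    simp [hν]
  refine ⟨((interleave n).trans σ).trans w₀, fun l hl => ?_⟩
  have hrel : IsAffineRelation (fun i => ((((interleave n).trans σ).trans w₀) i : Fin n → ℝ))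
      (l₀ ∘ ((interleave n).trans σ)) := hl₀.comp_perm ((interleave n).trans σ)
  obtain ⟨c, hc⟩ := (hW.isUniqueRelation _ hrel).2 l hl.2.1 hl.2.2
  have hc0 : c ≠ 0 := fun h => hl.1 (by rw [hc, h, zero_smul])
  have hlν : ∀ i, l i = c * ν (interleave n i) := fun i => by
    rw [hc, hν, natExt_coe]
    rfl
  have hscale : ∀ r : ℝ, ∑ i ∈ range (n + 2), r * ν i = 0 := fun r => by
    rw [← mul_sum, hν0, mul_zero]
  have habs : 0 < |c| := abs_pos.2 hc0
  rcases exists_sign_alternating (μ := fun k => ∑ i ∈ range (k + 1), ν i) hn hσ with h | h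
  · refine ⟨fun i => |c| * ν i, hscale _, fun k hk => ?_, ?_⟩
    · rw [← mul_sum, mul_left_comm]
      exact mul_pos habs (h k hk)
    · rcases abs_choice c with h1 | h1
      · exact Or.inl fun i => by rw [hlν, h1]
      · exact Or.inr fun i => by simp only [hlν, h1, neg_mul]
  · refine ⟨fun i => -|c| * ν i, hscale _, fun k hk => ?_, ?_⟩
    · rw [← mul_sum, neg_mul, ← mul_neg, mul_left_comm]
      exact mul_pos habs (h k hk)
    · rcases abs_choice c with h1 | h1
      · exact Or.inr fun i => by simp only [hlν, h1, neg_mul]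
      · exact Or.inl fun i => by rw [hlν, h1, neg_neg]

theorem exists_system_of_isWrittenAs {n : ℕ} (hn : 1 ≤ n) {W : Set (Fin n → ℝ)}
    (hW : IsCircuit W) (w : Fin (n + 2) ≃ W) {l : Fin (n + 2) → ℝ}
    (hl : IsAffineRelation (fun i => (w i : Fin n → ℝ)) l) {m : ℕ} {α β : ℕ → ℝ}
    (hm : m = (n + 3) / 2) (hwr : ∀ i : Fin (n + 2),
      l i = if (i : ℕ) + 1 ≤ m then α (i + 1) else -β (i + 1))
    (hαpos : ∀ i ∈ Icc 1 m, 0 < α i)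
    (h : ∀ r ∈ Icc 1 (n / 2),
        ∑ i ∈ Icc 1 r, α i < ∑ i ∈ Icc (m + 1) (m + r), β i ∧
        ∑ i ∈ Icc (m + 1) (m + r), β i < ∑ i ∈ Icc 1 (r + 1), α i) :
    ∃ f : Fin n → GenPoly n, systemSupport f = W ∧ (nondegPosSolutions f).encard = n + 1 := by
  have hrel : IsAffineRelation (fun i => (((interleave n).symm.trans w) i : Fin n → ℝ))
      (l ∘ (interleave n).symm) := hl.comp_perm (interleave n).symm
  refine exists_system_of_alternating hn _ (hW.isUniqueRelation _ hrel)
    (alternating_of_inequalities (by rw [sum_range]; simpa using hrel.2.1) hm (fun i hi => ?_)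
      (fun i hi => ?_) hαpos h)
  · have h1 : (interleave n).symm ⟨2 * i, hi⟩ = ⟨i, by omega⟩ := by
      rw [Equiv.symm_apply_eq]
      ext
      simp only [interleave, Equiv.coe_fn_mk]
      split_ifs <;> omega
    rw [natExt_of_lt _ hi, Function.comp_apply, h1, hwr, if_pos (by dsimp only; omega)]
  · have h1 : (interleave n).symm ⟨2 * i + 1, hi⟩ = ⟨m + i, by omega⟩ := by
      rw [Equiv.symm_apply_eq]
      ext
      simp only [interleave, Equiv.coe_fn_mk]
      split_ifs <;> omega
    rw [natExt_of_lt _ hi, Function.comp_apply, h1, hwr, if_neg (by dsimp only; omega), neg_neg]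

end Circuit

theorem theorem1 (n : ℕ) (hn : 1 ≤ n) (W : Set (Fin n → ℝ)) (hW : Circuit.IsCircuit W) :
    (∃ f : Fin n → Circuit.GenPoly n,
      Circuit.systemSupport f = W ∧ (Circuit.nondegPosSolutions f).encard = n + 1) ↔
    ∃ w : Fin (n + 2) ≃ W, ∀ l : Fin (n + 2) → ℝ,
      Circuit.IsAffineRelation (fun i => (w i : Fin n → ℝ)) l →
      ∃ (m : ℕ) (α β : ℕ → ℝ), m = (n + 3) / 2 ∧
        Circuit.IsWrittenAs l m α β ∧
        (∀ i ∈ Finset.Icc 1 m, 0 < α i) ∧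
        (∀ i ∈ Finset.Icc (m + 1) (n + 2), 0 < β i) ∧
        ∀ r ∈ Finset.Icc 1 (n / 2),
          ∑ i ∈ Finset.Icc 1 r, α i < ∑ i ∈ Finset.Icc (m + 1) (m + r), β i ∧
          ∑ i ∈ Finset.Icc (m + 1) (m + r), β i < ∑ i ∈ Finset.Icc 1 (r + 1), α i := by
  constructor
  · rintro ⟨f, hf, hcard⟩
    obtain ⟨w, hw⟩ := Circuit.exists_numbering_of_system hn hW hf hcard
    refine ⟨w, fun l hl => ?_⟩
    obtain ⟨ν, hν, halt, h⟩ := hw l hl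
    exact Circuit.exists_isWrittenAs_of_alternating hν halt h
  · rintro ⟨w, hw⟩
    obtain ⟨l, hl⟩ := hW.exists_isAffineRelation w
    obtain ⟨m, α, β, hm, hwr | hwr, hα, -, h⟩ := hw l hl
    · exact Circuit.exists_system_of_isWrittenAs hn hW w hl hm hwr hα h
    · exact Circuit.exists_system_of_isWrittenAs hn hW w hl.neg hm hwr hα h
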